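/- **Definitions.** A Boolean function is a map $f:\{0,1\}^n\to\{0,1\}$ with $n\ge 1$. For classes $I,J$ of Boolean functions, $IJ$ is the class of all compositions $f(g_1,\dots,g_n)$ with $f\in I$ $n$-ary and $g_1,\dots,g_n\in J$ all of the same arity. A clone is a class $C$ that contains all projections and satisfies $CC\subseteq C$. For clones $C_1,C_2$, a class $K$ is $(C_1,C_2)$-stable if $KC_1\subseteq K$ and $C_2K\subseteq K$. Let $\mathbf 0=(0,\dots,0)$, $\mathbf 1=(1,\dots,1)$, and let $\overline{\mathbf a}$ be the componentwise complement of $\mathbf a$. Let $\overline{f}(\mathbf a)=1-f(\mathbf a)$ and $\overline C=\{\overline f: f\in C\}$. For a class $C$ and $a,b\in\{0,1\}$ let $C_{a*}=\{f\in C: f(\mathbf 0)=a\}$, $C_{*b}=\{f\in C: f(\mathbf 1)=b\}$, $C_{ab}=C_{a*}\cap C_{*b}$; for $\diamond\in\{=,\neq,\le,\ge\}$ let $C_\diamond=\{f\in C: f(\mathbf 0)\diamond f(\mathbf 1)\}$; and let $C_{\neq,00}=C_{\neq}\cup C_{00}$, $C_{\neq,11}=C_{\neq}\cup C_{11}$.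 Let $\Omega$ be the class of all Boolean functions; $I_c$ the class of projections; $M$ the class of monotone functions; $S$ the class of self-dual functions ($f(\mathbf a)=1-f(\overline{\mathbf a})$ for all $\mathbf a$); $R$ the class of reflexive functions ($f(\mathbf a)=f(\overline{\mathbf a})$ for all $\mathbf a$); $S^-$ and $S^+$ the classes of minorants, respectively majorants, of self-dual functions; $U$ the class of functions such that $f(\mathbf a)=f(\mathbf b)=1$ implies $\mathbf a\wedge\mathbf b\ne\mathbf 0$; $W$ the class of functions such that $f(\mathbf a)=f(\mathbf b)=0$ implies $\mathbf a\vee\mathbf b\neq\mathbf 1$; $\mathcal C$ the class of constant functions, $\mathcal C_0=\mathcal C_{00}$ and $\mathcal C_1=\mathcal C_{11}$. Write $T_0=\Omega_{0*}$, $T_1=\Omega_{*1}$, $T_c=\Omega_{01}$, $M_0=M_{0*}$, $M_1=M_{*1}$, $M_c=M_{01}$, $S_c=S_{01}$, $SM=S\cap M$, $T_cU=U_{01}$, $MU=M\cap U$, $M_cU=(M\cap U)_{01}$, $T_cW=W_{01}$, $MW=M\cap W$, $M_cW=(M\cap W)_{01}$. **Theorem.** There are exactly 93 $(I_c,SM)$-stable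 classes of Boolean functions; they are the classes $K$ in the following table (each entry is written $K:\ C_1^K,\ C_2^K$). For each of them $C_1^K$ and $C_2^K$ are clones such that, for every clone $C$, $$KC\subseteq K\iff C\subseteq C_1^K,\qquad CK\subseteq K\iff C\subseteq C_2^K .$$ Consequently, for every clone $C_1$ and every clone $C_2\supseteq SM$, the $(C_1,C_2)$-stable classes are exactly the $K$ in the table with $C_1\subseteq C_1^K$ and $C_2\subseteq C_2^K$. Table: - $\Omega:\ \Omega,\Omega$ - $\Omega_{\le}:\ T_c,M$; $\ \Omega_{\ge}:\ T_c,M$; $\ \Omega_{\neq,00}:\ T_c,U$; $\ \Omega_{\neq,11}:\ T_c,W$ - $\Omega_{=}:\ T_c,\Omega$; $\ \Omega_{\neq}:\ T_c,S$ - $\Omega_{0*}\cup\mathcal C:\ T_0,M$; $\ \Omega_{1*}\cup\mathcal C:\ T_0,M$; $\ \Omega_{*0}\cup\mathcal C:\ T_1,M$; $\ \Omega_{*1}\cup\mathcal C:\ T_1,M$ - $\Omega_{0*}:\ T_0,T_0$; $\ \Omega_{1*}:\ T_0,T_1$; $\ \Omega_{*0}:\ T_1,T_0$; $\ \Omega_{*1}:\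 T_1,T_1$ - $\Omega_{00}\cup\mathcal C:\ T_c,M$; $\ \Omega_{11}\cup\mathcal C:\ T_c,M$; $\ \Omega_{00}:\ T_c,T_0$; $\ \Omega_{11}:\ T_c,T_1$ - $\Omega_{01}\cup\mathcal C:\ T_c,M$; $\ \Omega_{10}\cup\mathcal C:\ T_c,M$; $\ \Omega_{01}\cup\mathcal C_0:\ T_c,M_0$; $\ \Omega_{10}\cup\mathcal C_1:\ T_c,M_1$; $\ \Omega_{01}\cup\mathcal C_1:\ T_c,M_1$; $\ \Omega_{10}\cup\mathcal C_0:\ T_c,M_0$; $\ \Omega_{01}:\ T_c,T_c$; $\ \Omega_{10}:\ T_c,T_c$ - $S^-:\ S,U$; $\ S^-_{\neq}:\ S_c,SM$; $\ S^-_{0*}:\ S_c,U$; $\ S^-_{*0}:\ S_c,U$; $\ S^-_{01}\cup\mathcal C_0:\ S_c,MU$; $\ S^-_{10}\cup\mathcal C_0:\ S_c,MU$; $\ S^-_{01}:\ S_c,T_cU$; $\ S^-_{10}:\ S_c,T_cU$; $\ S^-_{00}:\ S_c,U$ - $S^+:\ S,W$; $\ S^+_{\neq}:\ S_c,SM$;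 $\ S^+_{1*}:\ S_c,W$; $\ S^+_{*1}:\ S_c,W$; $\ S^+_{10}\cup\mathcal C_1:\ S_c,MW$; $\ S^+_{01}\cup\mathcal C_1:\ S_c,MW$; $\ S^+_{10}:\ S_c,T_cW$; $\ S^+_{01}:\ S_c,T_cW$; $\ S^+_{11}:\ S_c,W$ - $S:\ S,S$; $\ S_c:\ S_c,S_c$; $\ \overline{S_c}:\ S_c,S_c$; $\ SM:\ SM,SM$; $\ \overline{SM}:\ SM,SM$ - $M:\ M,M$; $\ \overline M:\ M,M$; $\ M_0:\ M_0,M_0$; $\ \overline{M_0}:\ M_0,M_1$; $\ M_1:\ M_1,M_1$; $\ \overline{M_1}:\ M_1,M_0$; $\ M_c:\ M_c,M_c$; $\ \overline{M_c}:\ M_c,M_c$ - $U:\ U,U$; $\ T_cU\cup\mathcal C_0:\ T_cU,MU$; $\ T_cU:\ T_cU,T_cU$; $\ MU:\ MU,MU$; $\ M_cU:\ M_cU,M_cU$; $\ U_{00}:\ T_cU,U$ - $\overline U:\ U,W$; $\ \overline{T_cU}\cup\mathcal C_1:\ T_cU,MW$; $\ \overline{T_cU}:\ T_cU,T_cW$;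 $\ \overline{MU}:\ MU,MW$; $\ \overline{M_cU}:\ M_cU,M_cW$; $\ \overline U_{11}:\ T_cU,W$ - $W:\ W,W$; $\ T_cW\cup\mathcal C_1:\ T_cW,MW$; $\ T_cW:\ T_cW,T_cW$; $\ MW:\ MW,MW$; $\ M_cW:\ M_cW,M_cW$; $\ W_{11}:\ T_cW,W$ - $\overline W:\ W,U$; $\ \overline{T_cW}\cup\mathcal C_0:\ T_cW,MU$; $\ \overline{T_cW}:\ T_cW,T_cU$; $\ \overline{MW}:\ MW,MU$; $\ \overline{M_cW}:\ M_cW,M_cU$; $\ \overline W_{00}:\ T_cW,U$ - $U\cap\overline W:\ SM,U$; $\ W\cap\overline U:\ SM,W$ - $R:\ S,\Omega$; $\ R_{00}\cup\mathcal C:\ S_c,M$; $\ R_{11}\cup\mathcal C:\ S_c,M$; $\ R_{00}:\ S_c,T_0$; $\ R_{11}:\ S_c,T_1$ - $\mathcal C:\ \Omega,\Omega$; $\ \mathcal C_0:\ \Omega,T_0$; $\ \mathcal C_1:\ \Omega,T_1$; $\ \emptyset:\ \Omega,\Omega$ -/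

import Mathlib

namespace BoolMinion

/-! ### Functions of several arguments, function class composition, clones, stability -/

/-- A function of several arguments from `A` to `B`: a positive arity `n` together with a map
`A ^ n → B`. -/
abbrev MultiFun (A B : Type*) : Type _ := Σ n : ℕ+, ((Fin n → A) → B)

/-- A class of functions of several arguments from `A` to `B`. -/
abbrev FunClass (A B : Type*) : Type _ := Set (MultiFun A B)

/-- The composition `I J` of function classes: all `f (g₁, …, gₙ)` with `f` an `n`-ary member of
`I` and `g₁, …, gₙ` members of `J`, all of the same arity `m`. -/
def comp {A B C : Type*} (I : FunClass B C) (J : FunClass A B) : FunClass A C :=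
  {h | ∃ (n m : ℕ+) (f : (Fin n → B) → C) (g : Fin n → (Fin m → A) → B),
    (⟨n, f⟩ : MultiFun B C) ∈ I ∧ (∀ i, (⟨m, g i⟩ : MultiFun A B) ∈ J) ∧
      h = ⟨m, fun a => f fun i => g i a⟩}

/-- The class of all projections on `A`. -/
def projections (A : Type*) : FunClass A A :=
  {f | ∃ (n : ℕ+) (i : Fin n), f = ⟨n, fun a => a i⟩}

/-- A clone on `A`: it contains all projections and is closed under composition. -/
def IsClone {A : Type*} (C : FunClass A A) : Prop :=
  projections A ⊆ C ∧ comp C C ⊆ C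

/-- `F` is `(C₁, C₂)`-stable: `F C₁ ⊆ F` and `C₂ F ⊆ F`. -/
def IsStable {A B : Type*} (C₁ : FunClass A A) (C₂ : FunClass B B) (F : FunClass A B) : Prop :=
  comp F C₁ ⊆ F ∧ comp C₂ F ⊆ F

/-! ### Boolean functions; `false` and `true` play the roles of `0` and `1` -/

/-- A Boolean function. -/
abbrev BoolFun : Type := MultiFun Bool Bool

/-- A class of Boolean functions. -/
abbrev BoolClass : Type := FunClass Bool Bool

/-- The value of `f` at the tuple `(0, …, 0)`. -/
def atZero (f : BoolFun) : Bool := f.2 fun _ => false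

/-- The value of `f` at the tuple `(1, …, 1)`. -/
def atOne (f : BoolFun) : Bool := f.2 fun _ => true

/-- The componentwise complement of a tuple. -/
def barTuple {n : ℕ} (a : Fin n → Bool) : Fin n → Bool := fun i => !(a i)

/-- `C_{a*}`, the members of `C` with `f(0,…,0) = a`. -/
def val0 (C : BoolClass) (a : Bool) : BoolClass := {f ∈ C | atZero f = a}

/-- `C_{*b}`, the members of `C` with `f(1,…,1) = b`. -/
def val1 (C : BoolClass) (b : Bool) : BoolClass := {f ∈ C | atOne f = b}

/-- `C_{ab}`, the members of `C` with `f(0,…,0) = a` and `f(1,…,1) = b`. -/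
def val (C : BoolClass) (a b : Bool) : BoolClass := val0 C a ∩ val1 C b

/-- `C_=`, the members of `C` with `f(0,…,0) = f(1,…,1)`. -/
def valEq (C : BoolClass) : BoolClass := {f ∈ C | atZero f = atOne f}

/-- `C_≠`, the members of `C` with `f(0,…,0) ≠ f(1,…,1)`. -/
def valNe (C : BoolClass) : BoolClass := {f ∈ C | atZero f ≠ atOne f}

/-- `C_≤`, the members of `C` with `f(0,…,0) ≤ f(1,…,1)`. -/
def valLe (C : BoolClass) : BoolClass := {f ∈ C | atZero f ≤ atOne f}

/-- `C_≥`, the members of `C` with `f(0,…,0) ≥ f(1,…,1)`. -/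
def valGe (C : BoolClass) : BoolClass := {f ∈ C | atZero f ≥ atOne f}

/-- `C_{≠,00}`, the union of `C_≠` and `C_{00}`. -/
def valNe00 (C : BoolClass) : BoolClass := valNe C ∪ val C false false

/-- `C_{≠,11}`, the union of `C_≠` and `C_{11}`. -/
def valNe11 (C : BoolClass) : BoolClass := valNe C ∪ val C true true

/-- The (outer) negation of a Boolean function. -/
def negFun (f : BoolFun) : BoolFun := ⟨f.1, fun a => !(f.2 a)⟩

/-- The class of the negations of the members of `C`. -/
def neg (C : BoolClass) : BoolClass := negFun '' C

/-- The class of all Boolean functions. -/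
def clAll : BoolClass := Set.univ

/-- The class of projections. -/
def clIc : BoolClass := projections Bool

/-- Reflexive functions: `f(a) = f(ā)`. -/
def clRefl : BoolClass := {f | ∀ a, f.2 a = f.2 (barTuple a)}

/-- Self-dual functions: `f(a)` is the negation of `f(ā)`. -/
def clS : BoolClass := {f | ∀ a, f.2 a = !(f.2 (barTuple a))}

/-- Minorants of self-dual functions. -/
def clSmin : BoolClass :=
  {f | ∃ g : (Fin f.1 → Bool) → Bool, (⟨f.1, g⟩ : BoolFun) ∈ clS ∧ ∀ a, f.2 a ≤ g a}

/-- Majorants of self-dual functions. -/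
def clSmaj : BoolClass :=
  {f | ∃ g : (Fin f.1 → Bool) → Bool, (⟨f.1, g⟩ : BoolFun) ∈ clS ∧ ∀ a, f.2 a ≥ g a}

/-- Monotone functions. -/
def clM : BoolClass := {f | ∀ a b, a ≤ b → f.2 a ≤ f.2 b}

/-- `1`-separating functions of rank `2`. -/
def clU : BoolClass := {f | ∀ a b, f.2 a = true → f.2 b = true → a ⊓ b ≠ ⊥}

/-- `0`-separating functions of rank `2`. -/
def clW : BoolClass := {f | ∀ a b, f.2 a = false → f.2 b = false → a ⊔ b ≠ ⊤}

/-- Constant functions (of any positive arity). -/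
def clC : BoolClass := {f | ∃ c : Bool, ∀ a, f.2 a = c}

/-- Constant functions with value `0`. -/
def clC0 : BoolClass := val clC false false

/-- Constant functions with value `1`. -/
def clC1 : BoolClass := val clC true true

/-- `T_{0*}`. -/
def clT0 : BoolClass := val0 clAll false

/-- `T_{*1}`. -/
def clT1 : BoolClass := val1 clAll true

/-- `T_{01}`. -/
def clTc : BoolClass := val clAll false true

/-- Zero-preserving monotone functions. -/
def clM0 : BoolClass := val0 clM false

/-- One-preserving monotone functions. -/
def clM1 : BoolClass := val1 clM true

/-- Idempotent monotone functions. -/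
def clMc : BoolClass := val clM false true

/-- Idempotent self-dual functions. -/
def clSc : BoolClass := val clS false true

/-- Self-dual monotone functions. -/
def clSM : BoolClass := clS ∩ clM

/-- `U_{01}`. -/
def clTcU : BoolClass := val clU false true

/-- `M ∩ U`. -/
def clMU : BoolClass := clM ∩ clU

/-- `(M ∩ U)_{01}`. -/
def clMcU : BoolClass := val clMU false true

/-- `W_{01}`. -/
def clTcW : BoolClass := val clW false true

/-- `M ∩ W`. -/
def clMW : BoolClass := clM ∩ clW

/-- `(M ∩ W)_{01}`. -/
def clMcW : BoolClass := val clMW false true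

/-! ### The table -/

/-- A row of the table: a class `K`, a class `right` (meant to be the largest clone `C` with
`K C ⊆ K`) and a class `left` (meant to be the largest clone `C` with `C K ⊆ K`). -/
structure Row where
  /-- the class `K` -/
  K : BoolClass
  /-- the entry for right composition -/
  right : BoolClass
  /-- the entry for left composition -/
  left : BoolClass

/-- The list of the classes with their two associated clones. -/
def table : List Row := [
  ⟨clAll, clAll, clAll⟩,
  ⟨valLe clAll, clTc, clM⟩,
  ⟨valGe clAll, clTc, clM⟩,
  ⟨valNe00 clAll, clTc, clU⟩,
  ⟨valNe11 clAll, clTc, clW⟩,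
  ⟨valEq clAll, clTc, clAll⟩,
  ⟨valNe clAll, clTc, clS⟩,
  ⟨val0 clAll false ∪ clC, clT0, clM⟩,
  ⟨val0 clAll true ∪ clC, clT0, clM⟩,
  ⟨val1 clAll false ∪ clC, clT1, clM⟩,
  ⟨val1 clAll true ∪ clC, clT1, clM⟩,
  ⟨val0 clAll false, clT0, clT0⟩,
  ⟨val0 clAll true, clT0, clT1⟩,
  ⟨val1 clAll false, clT1, clT0⟩,
  ⟨val1 clAll true, clT1, clT1⟩,
  ⟨val clAll false false ∪ clC, clTc, clM⟩,
  ⟨val clAll true true ∪ clC, clTc, clM⟩,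
  ⟨val clAll false false, clTc, clT0⟩,
  ⟨val clAll true true, clTc, clT1⟩,
  ⟨val clAll false true ∪ clC, clTc, clM⟩,
  ⟨val clAll true false ∪ clC, clTc, clM⟩,
  ⟨val clAll false true ∪ clC0, clTc, clM0⟩,
  ⟨val clAll true false ∪ clC1, clTc, clM1⟩,
  ⟨val clAll false true ∪ clC1, clTc, clM1⟩,
  ⟨val clAll true false ∪ clC0, clTc, clM0⟩,
  ⟨val clAll false true, clTc, clTc⟩,
  ⟨val clAll true false, clTc, clTc⟩,
  ⟨clSmin, clS, clU⟩,
  ⟨clSmaj, clS, clW⟩,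
  ⟨valNe clSmin, clSc, clSM⟩,
  ⟨valNe clSmaj, clSc, clSM⟩,
  ⟨val0 clSmin false, clSc, clU⟩,
  ⟨val0 clSmaj true, clSc, clW⟩,
  ⟨val1 clSmin false, clSc, clU⟩,
  ⟨val1 clSmaj true, clSc, clW⟩,
  ⟨val clSmin false true ∪ clC0, clSc, clMU⟩,
  ⟨val clSmaj true false ∪ clC1, clSc, clMW⟩,
  ⟨val clSmin true false ∪ clC0, clSc, clMU⟩,
  ⟨val clSmaj false true ∪ clC1, clSc, clMW⟩,
  ⟨val clSmin false true, clSc, clTcU⟩,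
  ⟨val clSmaj true false, clSc, clTcW⟩,
  ⟨val clSmin true false, clSc, clTcU⟩,
  ⟨val clSmaj false true, clSc, clTcW⟩,
  ⟨val clSmin false false, clSc, clU⟩,
  ⟨val clSmaj true true, clSc, clW⟩,
  ⟨clS, clS, clS⟩,
  ⟨clSc, clSc, clSc⟩,
  ⟨neg clSc, clSc, clSc⟩,
  ⟨clM, clM, clM⟩,
  ⟨neg clM, clM, clM⟩,
  ⟨clM0, clM0, clM0⟩,
  ⟨neg clM0, clM0, clM1⟩,
  ⟨clM1, clM1, clM1⟩,
  ⟨neg clM1, clM1, clM0⟩,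
  ⟨clMc, clMc, clMc⟩,
  ⟨neg clMc, clMc, clMc⟩,
  ⟨clSM, clSM, clSM⟩,
  ⟨neg clSM, clSM, clSM⟩,
  ⟨clU, clU, clU⟩,
  ⟨neg clU, clU, clW⟩,
  ⟨clTcU ∪ clC0, clTcU, clMU⟩,
  ⟨neg clTcU ∪ clC1, clTcU, clMW⟩,
  ⟨clTcU, clTcU, clTcU⟩,
  ⟨neg clTcU, clTcU, clTcW⟩,
  ⟨clMU, clMU, clMU⟩,
  ⟨neg clMU, clMU, clMW⟩,
  ⟨clMcU, clMcU, clMcU⟩,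
  ⟨neg clMcU, clMcU, clMcW⟩,
  ⟨clW, clW, clW⟩,
  ⟨neg clW, clW, clU⟩,
  ⟨clTcW ∪ clC1, clTcW, clMW⟩,
  ⟨neg clTcW ∪ clC0, clTcW, clMU⟩,
  ⟨clTcW, clTcW, clTcW⟩,
  ⟨neg clTcW, clTcW, clTcU⟩,
  ⟨clMW, clMW, clMW⟩,
  ⟨neg clMW, clMW, clMU⟩,
  ⟨clMcW, clMcW, clMcW⟩,
  ⟨neg clMcW, clMcW, clMcU⟩,
  ⟨val clU false false, clTcU, clU⟩,
  ⟨val (neg clU) true true, clTcU, clW⟩,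
  ⟨val clW true true, clTcW, clW⟩,
  ⟨val (neg clW) false false, clTcW, clU⟩,
  ⟨clU ∩ neg clW, clSM, clU⟩,
  ⟨clW ∩ neg clU, clSM, clW⟩,
  ⟨clRefl, clS, clAll⟩,
  ⟨val clRefl false false ∪ clC, clSc, clM⟩,
  ⟨val clRefl true true ∪ clC, clSc, clM⟩,
  ⟨val clRefl false false, clSc, clT0⟩,
  ⟨val clRefl true true, clSc, clT1⟩,
  ⟨clC, clAll, clAll⟩,
  ⟨clC0, clAll, clT0⟩,
  ⟨clC1, clAll, clT1⟩,
  ⟨∅, clAll, clAll⟩]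

end BoolMinion

/-!
Let `K` be stable under minors and under self-dual monotone functions from the left. The median is
self-dual and monotone, so `K` is stable under the median, and the argument of Baker and Pixley
(`mem_of_forall_pair`) shows that `f` belongs to `K` as soon as every pair `(f a, f b)` is a pair
of values of a member of `K` at `a` and `b`. Since `K` is closed under minors, the possible value
pairs depend only on the set of columns `(aᵢ, bᵢ)`, which is one of 16 binary relations `T` on
`{0, 1}`. Hence `K` is determined by the pairs of values that are forbidden on each `T`, that is,
by a mask of 64 bits; `avoiding m` is the class of functions defined by the mask `m`. Conversely,
each class `avoiding m` is stable (`isStable_avoiding`).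

Different masks may define the same class. If `(x, z)` is forbidden at `a`, `c`, or `(z, y)` is
forbidden at `c`, `b`, for each value `z`, then `(x, y)` is forbidden at `a`, `b`; what is forbidden
on a relation is forbidden on smaller relations, and exchanging `a` and `b` changes nothing.
`maskClosure` adds forbidden pairs according to these rules. A mask that is closed under all of
them is called `Consistent`, and then each pair that is not forbidden is attained by a function in
the class: a partial function on tuples that respects the mask can be extended by one tuple at a
time, because subsets of `{0, 1}` that meet pairwise have a common element
(`Consistent.exists_mem_avoiding`). So consistent masks correspond bijectively to stable classes.

For a consistent mask both clones can be read off. `C K ⊆ K` holds if and only if the members of `C`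
preserve the relation of possible value pairs on each `T` (`Consistent.comp_subset_iff_left`), and
`K C ⊆ K` holds if and only if they preserve each `T` that cannot be enlarged without making more
value pairs possible (`Consistent.comp_subset_iff_right`).

The rest is a finite computation with masks, carried out by the kernel. `encodes_table` gives masks
for the three classes of each row. The closures of the masks of the classes `K` are consistent and
distinct, they are closed under forbidding one more pair, up to closure (`masks_closed`), and they
lead to the clones in the table.
-/

namespace BoolMinion

/-! ### Encoding of binary relations and of forbidden pairs of values -/

/-- The number in `{0, 1, 2, 3}` that encodes the pair `(s, t)`. -/
def ix (s t : Bool) : ℕ := 2 * s.toNat + t.toNat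

/-- All columns `(aᵢ, bᵢ)` belong to the binary relation on `Bool` encoded by the bits of `T`. -/
def Cols (T : ℕ) {n : ℕ} (a b : Fin n → Bool) : Prop := ∀ i, T.testBit (ix (a i) (b i)) = true

/-- The class of functions defined by the 64-bit mask `m`: bit `4 T + ix x y` of `m` forbids that
`(f a, f b) = (x, y)` for some `a`, `b` whose columns all belong to the relation `T`. -/
def avoiding (m : ℕ) : BoolClass :=
  {f | ∀ T < 16, ∀ a b, Cols T a b → m.testBit (4 * T + ix (f.2 a) (f.2 b)) = false}

/-- The set of value pairs forbidden by `m` on the relation `T`. It occurs in all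
closure computations, so it is written with the `Nat` primitives that the kernel evaluates
natively. -/
def nib (m T : ℕ) : ℕ := Nat.land (Nat.shiftRight m (Nat.mul 4 T)) 15

/-- The pairs `(x, y)` such that for each `z` either `(x, z)` is forbidden by `u` or `(z, y)` is
forbidden by `v`. -/
def resolve (u v : ℕ) : ℕ :=
  Nat.land (Nat.lor (Nat.mul 3 (Nat.land u 5)) (Nat.mul 5 (Nat.land v 3)))
    (Nat.lor (Nat.mul 3 (Nat.land (Nat.shiftRight u 1) 5)) (Nat.mul 5 (Nat.shiftRight v 2)))

/-- The converse of the relation `T`. -/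
def swapRel (T : ℕ) : ℕ := (T &&& 9) ||| ((T &&& 2) <<< 1) ||| ((T >>> 1) &&& 2)

/-- The mask `m` read with the two arguments exchanged, both in the relations and in the values. -/
def swapMask (m : ℕ) : ℕ :=
  let m' := (m &&& 0x9999999999999999) ||| ((m &&& 0x2222222222222222) <<< 1) |||
    ((m >>> 1) &&& 0x2222222222222222)
  (m' &&& 0xff0000ffff0000ff) ||| ((m' &&& 0x0000ff000000ff00) <<< 8) |||
    ((m' >>> 8) &&& 0x0000ff000000ff00)

/-- The mask `m` with the values `0` and `1` exchanged. -/
def flip (m : ℕ) : ℕ :=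
  ((m &&& 0x1111111111111111) <<< 3) ||| ((m &&& 0x2222222222222222) <<< 1) |||
    ((m >>> 1) &&& 0x2222222222222222) ||| ((m >>> 3) &&& 0x1111111111111111)

theorem ix_lt (s t : Bool) : ix s t < 4 := by cases s <;> cases t <;> decide

theorem exists_ix {k : ℕ} (hk : k < 4) : ∃ s t, ix s t = k := by
  interval_cases k
  exacts [⟨false, false, rfl⟩, ⟨false, true, rfl⟩, ⟨true, false, rfl⟩, ⟨true, true, rfl⟩]

theorem nib_eq (m T : ℕ) : nib m T = (m >>> (4 * T)) &&& 15 := rfl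

theorem nib_lt (m T : ℕ) : nib m T < 16 :=
  lt_of_le_of_lt (by rw [nib_eq]; exact Nat.and_le_right) (by norm_num : 15 < 16)

theorem nib_testBit (m T : ℕ) (s t : Bool) :
    (nib m T).testBit (ix s t) = m.testBit (4 * T + ix s t) := by
  rw [nib_eq, Nat.testBit_and, Nat.testBit_shiftRight]
  cases s <;> cases t <;> simp [ix, Nat.testBit]

theorem testBit_eq_of_lt_16 {u v : ℕ} (hu : u < 16) (hv : v < 16)
    (h : ∀ s t, u.testBit (ix s t) = v.testBit (ix s t)) : u = v := by
  have key : ∀ u < 16, ∀ v < 16,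
      (∀ s t, u.testBit (ix s t) = v.testBit (ix s t)) → u = v := by decide +kernel
  exact key u hu v hv h

theorem resolve_lt {u v : ℕ} (hu : u < 16) (hv : v < 16) : resolve u v < 16 := by
  have key : ∀ u < 16, ∀ v < 16, resolve u v < 16 := by decide +kernel
  exact key u hu v hv

theorem resolve_testBit {u v : ℕ} (hu : u < 16) (hv : v < 16) (x y : Bool) :
    (resolve u v).testBit (ix x y) = true ↔
      ∀ z, u.testBit (ix x z) = true ∨ v.testBit (ix z y) = true := by
  have key : ∀ u < 16, ∀ v < 16, ∀ x y, (resolve u v).testBit (ix x y) = true ↔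
      ∀ z, u.testBit (ix x z) = true ∨ v.testBit (ix z y) = true := by decide +kernel
  exact key u hu v hv x y

theorem shiftLeft_testBit {c : ℕ} (hc : c < 16) (T S : ℕ) (s t : Bool) :
    (c <<< (4 * T)).testBit (4 * S + ix s t) = true ↔ S = T ∧ c.testBit (ix s t) = true := by
  have hk := ix_lt s t
  generalize ix s t = k at *
  rw [Nat.testBit_shiftLeft]
  rcases lt_trichotomy S T with h | h | h
  · have : ¬ 4 * T ≤ 4 * S + k := by omega
    simp [this, h.ne]
  · subst h; simp
  · have h2 : c.testBit (4 * S + k - 4 * T) = false :=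
      Nat.testBit_lt_two_pow (lt_of_lt_of_le hc
        (le_trans (by norm_num : 16 ≤ 2 ^ 4) (Nat.pow_le_pow_right (by norm_num) (by omega))))
    simp [h2, h.ne']

theorem swapMask_testBit (m : ℕ) {T : ℕ} (hT : T < 16) (s t : Bool) :
    (swapMask m).testBit (4 * T + ix s t) = m.testBit (4 * swapRel T + ix t s) := by
  interval_cases T <;> cases s <;> cases t <;>
    simp [swapMask, ix, swapRel, Nat.testBit_shiftLeft, Nat.testBit_shiftRight] <;>
    simp [Nat.testBit]

theorem flip_testBit (m : ℕ) {T : ℕ} (hT : T < 16) (s t : Bool) :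
    (flip m).testBit (4 * T + ix s t) = m.testBit (4 * T + ix (!s) (!t)) := by
  interval_cases T <;> cases s <;> cases t <;>
    simp [flip, ix, Nat.testBit_shiftLeft, Nat.testBit_shiftRight] <;>
    simp [Nat.testBit]

theorem swapRel_lt {T : ℕ} (hT : T < 16) : swapRel T < 16 := by
  revert T; decide

theorem swapRel_testBit {T : ℕ} (hT : T < 16) (s t : Bool) :
    (swapRel T).testBit (ix s t) = T.testBit (ix t s) := by
  revert T s t; decide

/-- Every binary relation on `Bool` is encoded by a number below `16`. -/
theorem exists_rel (p : Bool → Bool → Prop) :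
    ∃ T < 16, ∀ s t, T.testBit (ix s t) = true ↔ p s t := by
  classical
  have key : ∀ q : Bool → Bool → Bool, ∃ T < 16, ∀ s t, T.testBit (ix s t) = q s t := by
    decide +kernel
  obtain ⟨T, hT, h⟩ := key fun s t => decide (p s t)
  exact ⟨T, hT, fun s t => by rw [h, decide_eq_true_iff]⟩

/-- The relation consisting of the columns of two given tuples. -/
theorem exists_cols {n : ℕ} (a b : Fin n → Bool) :
    ∃ T < 16, ∀ s t, T.testBit (ix s t) = true ↔ ∃ i, a i = s ∧ b i = t :=
  exists_rel fun s t => ∃ i, a i = s ∧ b i = t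

theorem Cols.swap {T n : ℕ} {a b : Fin n → Bool} (hT : T < 16) (h : Cols T a b) :
    Cols (swapRel T) b a := fun i => by rw [swapRel_testBit hT]; exact h i

theorem Cols.mono {T S n : ℕ} {a b : Fin n → Bool} (h : Cols T a b)
    (hTS : ∀ s t, T.testBit (ix s t) = true → S.testBit (ix s t) = true) : Cols S a b :=
  fun i => hTS _ _ (h i)

/-! ### Classes defined by masks -/

theorem mem_avoiding {m : ℕ} {f : BoolFun} : f ∈ avoiding m ↔
    ∀ T < 16, ∀ a b, Cols T a b → m.testBit (4 * T + ix (f.2 a) (f.2 b)) = false := Iff.rfl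

theorem avoiding_zero : avoiding 0 = clAll :=
  Set.eq_univ_of_forall fun _ _ _ _ _ _ => Nat.zero_testBit _

theorem avoiding_lor (m m' : ℕ) : avoiding (m ||| m') = avoiding m ∩ avoiding m' := by
  ext f
  simp only [avoiding, Set.mem_ofPred_eq, Set.mem_inter_iff, Nat.testBit_or, Bool.or_eq_false_iff]
  exact ⟨fun h => ⟨fun T hT a b c => (h T hT a b c).1, fun T hT a b c => (h T hT a b c).2⟩,
    fun h T hT a b c => ⟨h.1 T hT a b c, h.2 T hT a b c⟩⟩

theorem avoiding_lor_eq_left {m d : ℕ} (h : avoiding m ⊆ avoiding d) :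
    avoiding (m ||| d) = avoiding m := by
  rw [avoiding_lor, Set.inter_eq_left.2 h]

/-- The mask that forbids the value pairs in `c` on the relation `T` only. -/
theorem mem_avoiding_shiftLeft {c T : ℕ} (hc : c < 16) (hT : T < 16) {f : BoolFun} :
    f ∈ avoiding (c <<< (4 * T)) ↔
      ∀ a b, Cols T a b → c.testBit (ix (f.2 a) (f.2 b)) = false := by
  simp only [mem_avoiding, ← Bool.not_eq_true, shiftLeft_testBit hc]
  constructor
  · intro h a b hab hx
    exact h T hT a b hab ⟨rfl, hx⟩
  · rintro h S hS a b hab ⟨rfl, hx⟩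
    exact h a b hab hx

theorem neg_avoiding (m : ℕ) : neg (avoiding m) = avoiding (flip m) := by
  ext f
  constructor
  · rintro ⟨g, hg, rfl⟩ T hT a b hab
    simpa [flip_testBit _ hT, negFun] using hg T hT a b hab
  · intro h
    refine ⟨negFun f, fun T hT a b hab => ?_, ?_⟩
    · simpa [flip_testBit _ hT, negFun] using h T hT a b hab
    · simp [negFun]

/-! ### Closure of masks -/

/-- The class of functions that preserve the binary relation `R`. -/
def pol (R : ℕ) : BoolClass := {f | ∀ a b, Cols R a b → R.testBit (ix (f.2 a) (f.2 b)) = true}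

/-- The mask that forbids on `R` all value pairs outside of `R`. -/
def polMask (R : ℕ) : ℕ := (15 - R) <<< (4 * R)

theorem compl_testBit {R : ℕ} (hR : R < 16) (s t : Bool) :
    (15 - R).testBit (ix s t) = !R.testBit (ix s t) := by
  revert R s t; decide

theorem avoiding_polMask {R : ℕ} (hR : R < 16) : avoiding (polMask R) = pol R := by
  ext f
  rw [polMask, mem_avoiding_shiftLeft (by omega) hR]
  simp only [compl_testBit hR, pol, Set.mem_ofPred_eq, Bool.not_eq_false']

/-- What holds for every Boolean function: no value pair occurs on the empty relation, and the
value pairs `(0, 1)` and `(1, 0)` do not occur on a subset of the diagonal. -/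
def axiomMask : ℕ := polMask 0 ||| 6 <<< (4 * 1) ||| 6 <<< (4 * 8) ||| 6 <<< (4 * 9)

/-- Shifts and bit masks that transfer what is forbidden on `T ∪ {k}` to `T`, for all relations `T`
that do not contain the pair `k`, in turn for `k = 0, 1, 2, 3`. -/
def monoShifts : List (ℕ × ℕ) := [(4, 0x0f0f0f0f0f0f0f0f), (8, 0x00ff00ff00ff00ff),
  (16, 0x0000ffff0000ffff), (32, 0x00000000ffffffff)]

/-- Transfer of forbidden pairs to relations that lack a given pair. -/
def monoStep (m : ℕ) (p : ℕ × ℕ) : ℕ := Nat.lor m (Nat.land (Nat.shiftRight m p.1) p.2)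

/-- Resolution of the pairs forbidden on `A` and on `B` gives pairs forbidden on `T`, where
`r = (T, A, B)`. -/
def resolveStep (m : ℕ) (r : ℕ × ℕ × ℕ) : ℕ :=
  Nat.lor m (Nat.shiftLeft (resolve (nib m r.2.1) (nib m r.2.2)) (Nat.mul 4 r.1))

/-- The triple `(T, A, B)` is admissible for resolution: there is a binary operation `φ` such that
`(s, φ s t) ∈ A` and `(φ s t, t) ∈ B` whenever `(s, t) ∈ T`. -/
def Admissible (r : ℕ × ℕ × ℕ) : Prop :=
  r.1 < 16 ∧ r.2.1 < 16 ∧ r.2.2 < 16 ∧ ∃ φ < 16, ∀ s t, r.1.testBit (ix s t) = true →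
    r.2.1.testBit (ix s (φ.testBit (ix s t))) = true ∧
      r.2.2.testBit (ix (φ.testBit (ix s t)) t) = true

instance : DecidablePred Admissible := fun r => by unfold Admissible; infer_instance

/-- Resolutions that suffice to compute closures. The intermediate tuple is in each case a constant
tuple, or one of the two given tuples, or the complement of one of them. -/
def rules : List (ℕ × ℕ × ℕ) := [(5, 5, 1), (10, 10, 8), (5, 10, 4), (10, 5, 2), (7, 11, 6),
  (11, 6, 14), (13, 6, 7), (14, 6, 11), (15, 10, 12), (15, 15, 9)]

/-- One round of all rules. -/
def step (m : ℕ) : ℕ :=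
  let m' := monoShifts.foldl monoStep (rules.foldl resolveStep m)
  Nat.lor m' (swapMask m')

/-- The mask of all pairs that are forbidden as a consequence of `m`; four rounds are enough for all
masks that occur. -/
def maskClosure (m : ℕ) : ℕ := step (step (step (step (m ||| axiomMask))))

theorem avoiding_axiomMask : avoiding axiomMask = Set.univ := by
  refine Set.eq_univ_of_forall fun f => ?_
  have diag : ∀ S < 16, (∀ s t, S.testBit (ix s t) = true → s = t) →
      f ∈ avoiding (6 <<< (4 * S)) := by
    intro S hS h
    refine (mem_avoiding_shiftLeft (by norm_num) hS).2 fun a b hab => ?_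
    have : a = b := funext fun i => h _ _ (hab i)
    subst this
    cases f.2 a <;> rfl
  simp only [axiomMask, avoiding_lor, Set.mem_inter_iff]
  refine ⟨⟨⟨?_, diag 1 (by decide) (by decide)⟩, diag 8 (by decide) (by decide)⟩,
    diag 9 (by decide) (by decide)⟩
  rw [avoiding_polMask (by decide)]
  intro a b hab
  simpa using hab ⟨0, f.1.pos⟩

theorem avoiding_monoStep {p : ℕ × ℕ} (hp : p ∈ monoShifts) (m : ℕ) :
    avoiding (monoStep m p) = avoiding m := by
  have key : ∀ p ∈ monoShifts, ∀ T < 16, ∀ x y, p.2.testBit (4 * T + ix x y) = true → ∃ S < 16,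
      p.1 + 4 * T = 4 * S ∧ ∀ s t, T.testBit (ix s t) = true → S.testBit (ix s t) = true := by
    decide +kernel
  refine avoiding_lor_eq_left (d := (m >>> p.1) &&& p.2) fun f hf T hT a b hab => ?_
  rw [Nat.testBit_and, Nat.testBit_shiftRight, Bool.and_eq_false_iff]
  by_contra! h
  obtain ⟨S, hS, hTS, hmono⟩ := key p hp T hT _ _ (by simpa using h.2)
  rw [← add_assoc, hTS] at h
  exact h.1 (hf S hS a b (hab.mono hmono))

theorem avoiding_resolveStep {r : ℕ × ℕ × ℕ} (hr : Admissible r) (m : ℕ) :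
    avoiding (resolveStep m r) = avoiding m := by
  obtain ⟨T, A, B⟩ := r
  obtain ⟨hT, hA, hB, φ, -, hφ⟩ := hr
  refine avoiding_lor_eq_left (d := resolve (nib m A) (nib m B) <<< (4 * T)) fun f hf => ?_
  refine (mem_avoiding_shiftLeft (resolve_lt (nib_lt _ _) (nib_lt _ _)) hT).2 fun a b hab => ?_
  rw [← Bool.not_eq_true, resolve_testBit (nib_lt _ _) (nib_lt _ _)]
  intro h
  -- resolve on the value at the tuple `c` obtained from `a` and `b` with the operation `φ`
  let c : Fin f.1 → Bool := fun i => φ.testBit (ix (a i) (b i))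
  have h1 := hf A hA a c fun i => (hφ _ _ (hab i)).1
  have h2 := hf B hB c b fun i => (hφ _ _ (hab i)).2
  rcases h (f.2 c) with h | h <;> rw [nib_testBit] at h <;> simp_all

theorem avoiding_swapMask (m : ℕ) : avoiding (Nat.lor m (swapMask m)) = avoiding m := by
  refine avoiding_lor_eq_left fun f hf T hT a b hab => ?_
  rw [swapMask_testBit m hT]
  exact hf _ (swapRel_lt hT) b a (hab.swap hT)

theorem avoiding_foldl {α : Type*} {g : ℕ → α → ℕ} {l : List α}
    (h : ∀ x ∈ l, ∀ m, avoiding (g m x) = avoiding m) (m : ℕ) :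
    avoiding (l.foldl g m) = avoiding m := by
  induction l generalizing m with
  | nil => rfl
  | cons x l ih =>
    rw [List.foldl_cons, ih fun y hy => h y (List.mem_cons_of_mem _ hy)]
    exact h x List.mem_cons_self m

theorem avoiding_step (m : ℕ) : avoiding (step m) = avoiding m := by
  have hr : ∀ r ∈ rules, Admissible r := by decide +kernel
  rw [step, avoiding_swapMask, avoiding_foldl fun p hp => avoiding_monoStep hp,
    avoiding_foldl fun r h => avoiding_resolveStep (hr r h)]

theorem avoiding_maskClosure (m : ℕ) : avoiding (maskClosure m) = avoiding m := by
  simp only [maskClosure, avoiding_step, avoiding_lor, avoiding_axiomMask, Set.inter_univ]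

/-! ### Consistent masks: every pair that is not forbidden occurs -/

/-- The relation `{(s, φ s t) | (s, t) ∈ T}`. -/
def leftImage (T φ : ℕ) : ℕ := (List.range 4).foldl (fun u k =>
  if T.testBit k then u ||| 1 <<< ix (k.testBit 1) (φ.testBit k) else u) 0

/-- The relation `{(φ s t, t) | (s, t) ∈ T}`. -/
def rightImage (T φ : ℕ) : ℕ := (List.range 4).foldl (fun u k =>
  if T.testBit k then u ||| 1 <<< ix (φ.testBit k) (k.testBit 0) else u) 0

/-- The mask `m` is closed under all rules that produce forbidden pairs. -/
def Consistent (m : ℕ) : Prop :=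
  m ||| axiomMask = m ∧ m ||| swapMask m = m ∧ (∀ p ∈ monoShifts, monoStep m p = m) ∧
    ∀ T < 16, ∀ φ < 16,
      resolve (nib m (leftImage T φ)) (nib m (rightImage T φ)) ||| nib m T = nib m T

instance : DecidablePred Consistent := fun m => by unfold Consistent; infer_instance

/-- The mask `m` does not forbid the values `x` at `a` and `y` at `b`. -/
def Compat (m : ℕ) {n : ℕ} (a b : Fin n → Bool) (x y : Bool) : Prop :=
  ∀ T < 16, Cols T a b → m.testBit (4 * T + ix x y) = false

theorem testBit_of_lor_eq {m d : ℕ} (h : m ||| d = m) {j : ℕ} (hj : d.testBit j = true) :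
    m.testBit j = true := by
  rw [← h, Nat.testBit_or, hj, Bool.or_true]

theorem leftImage_spec {T φ : ℕ} (hT : T < 16) (hφ : φ < 16) : leftImage T φ < 16 ∧
    ∀ s t, (leftImage T φ).testBit (ix s t) = true →
      ∃ t', T.testBit (ix s t') = true ∧ φ.testBit (ix s t') = t := by
  have key : ∀ T < 16, ∀ φ < 16, leftImage T φ < 16 ∧
    ∀ s t, (leftImage T φ).testBit (ix s t) = true →
      ∃ t', T.testBit (ix s t') = true ∧ φ.testBit (ix s t') = t := by decide +kernel
  exact key T hT φ hφ

theorem rightImage_spec {T φ : ℕ} (hT : T < 16) (hφ : φ < 16) : rightImage T φ < 16 ∧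
    ∀ s t, (rightImage T φ).testBit (ix s t) = true →
      ∃ s', T.testBit (ix s' t) = true ∧ φ.testBit (ix s' t) = s := by
  have key : ∀ T < 16, ∀ φ < 16, rightImage T φ < 16 ∧
    ∀ s t, (rightImage T φ).testBit (ix s t) = true →
      ∃ s', T.testBit (ix s' t) = true ∧ φ.testBit (ix s' t) = s := by decide +kernel
  exact key T hT φ hφ

namespace Consistent

variable {m : ℕ}

theorem mono_insert (h : Consistent m) {T c : ℕ} (hT : T < 16) (hc : c < 4) (x y : Bool)
    (hx : m.testBit (4 * (T ||| 1 <<< c) + ix x y) = true) :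
    m.testBit (4 * T + ix x y) = true := by
  have key : ∀ T < 16, ∀ c < 4, T ||| 1 <<< c = T ∨ ∃ p ∈ monoShifts,
      4 * (T ||| 1 <<< c) = p.1 + 4 * T ∧ ∀ x y, p.2.testBit (4 * T + ix x y) = true := by
    decide +kernel
  obtain h1 | ⟨p, hp, h1, h2⟩ := key T hT c hc
  · rwa [h1] at hx
  · refine testBit_of_lor_eq (h.2.2.1 p hp) (?_ : ((m >>> p.1) &&& p.2).testBit _ = true)
    rw [Nat.testBit_and, Nat.testBit_shiftRight, h2, ← add_assoc, ← h1, hx]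
    rfl

theorem mono (h : Consistent m) {T S : ℕ} (hT : T < 16) (hS : S < 16)
    (hTS : ∀ s t, T.testBit (ix s t) = true → S.testBit (ix s t) = true) (x y : Bool)
    (hx : m.testBit (4 * S + ix x y) = true) : m.testBit (4 * T + ix x y) = true := by
  have key : ∀ S < 16, ∀ T < 16, (∀ s t, T.testBit (ix s t) = true → S.testBit (ix s t) = true) →
      ∃ c₀ < 4, ∃ c₁ < 4, ∃ c₂ < 4, ∃ c₃ < 4,
        S = (((T ||| 1 <<< c₀) ||| 1 <<< c₁) ||| 1 <<< c₂) ||| 1 <<< c₃ ∨ S = T := by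
    decide +kernel
  have lt : ∀ {U c : ℕ}, U < 16 → c < 4 → U ||| 1 <<< c < 16 := by
    have : ∀ U < 16, ∀ c < 4, U ||| 1 <<< c < 16 := by decide +kernel
    exact fun {U c} hU hc => this U hU c hc
  obtain ⟨c₀, h₀, c₁, h₁, c₂, h₂, c₃, h₃, rfl | rfl⟩ := key S hS T hT hTS
  · exact h.mono_insert hT h₀ _ _ (h.mono_insert (lt hT h₀) h₁ _ _ (h.mono_insert
      (lt (lt hT h₀) h₁) h₂ _ _ (h.mono_insert (lt (lt (lt hT h₀) h₁) h₂) h₃ _ _ hx)))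
  · exact hx

theorem compat_swap (h : Consistent m) {n : ℕ} {a b : Fin n → Bool} {x y : Bool}
    (hc : Compat m a b x y) : Compat m b a y x := by
  intro T hT hab
  by_contra hx
  have h1 := hc _ (swapRel_lt hT) (hab.swap hT)
  have h2 : (swapMask m).testBit (4 * swapRel T + ix x y) = true := by
    have h3 : ∀ T < 16, swapRel (swapRel T) = T := by decide
    rw [swapMask_testBit m (swapRel_lt hT), h3 T hT]
    simpa using hx
  rw [testBit_of_lor_eq h.2.1 h2] at h1
  exact absurd h1 (by decide)

/-- Path consistency: compatible values at two tuples extend to every third tuple. -/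
theorem exists_compat (h : Consistent m) {n : ℕ} {a b : Fin n → Bool} {x y : Bool}
    (hc : Compat m a b x y) (c : Fin n → Bool) : ∃ z, Compat m a c x z ∧ Compat m c b z y := by
  obtain ⟨T, hT, hcols⟩ := exists_cols a b
  -- for each column of `a`, `b` choose the value of `c` at one position of that column
  have hv : ∀ s t, ∃ v, T.testBit (ix s t) = true → ∃ i, a i = s ∧ b i = t ∧ c i = v := by
    intro s t
    by_cases hst : T.testBit (ix s t) = true
    · obtain ⟨i, h1, h2⟩ := (hcols s t).1 hst
      exact ⟨c i, fun _ => ⟨i, h1, h2, rfl⟩⟩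
    · exact ⟨true, fun h => absurd h hst⟩
  choose v hv using hv
  obtain ⟨φ, hφ, hφc⟩ := exists_rel fun s t => v s t = true
  have hφ' : ∀ s t, T.testBit (ix s t) = true →
      ∃ i, a i = s ∧ b i = t ∧ c i = φ.testBit (ix s t) := fun s t hst => by
    rw [(Bool.eq_iff_iff.2 (hφc s t) : φ.testBit (ix s t) = v s t)]
    exact hv s t hst
  obtain ⟨hL, hL'⟩ := leftImage_spec hT hφ
  obtain ⟨hR, hR'⟩ := rightImage_spec hT hφ
  have h0 := hc T hT fun j => (hcols _ _).2 ⟨j, rfl, rfl⟩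
  have h1 : ¬ (resolve (nib m (leftImage T φ)) (nib m (rightImage T φ))).testBit (ix x y)
      = true := by
    intro h1
    rw [← nib_testBit, ← h.2.2.2 T hT φ hφ, Nat.testBit_or, h1] at h0
    exact absurd h0 (by simp)
  rw [resolve_testBit (nib_lt _ _) (nib_lt _ _)] at h1
  push Not at h1
  obtain ⟨z, h2, h3⟩ := h1
  rw [nib_testBit] at h2 h3
  refine ⟨z, fun S hS hac => ?_, fun S hS hcb => ?_⟩
  · by_contra hx
    refine h2 (h.mono hL hS (fun s t hst => ?_) _ _ (by simpa using hx))
    obtain ⟨t', ht', rfl⟩ := hL' s t hst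
    obtain ⟨i, rfl, rfl, hi⟩ := hφ' s t' ht'
    rw [← hi]
    exact hac i
  · by_contra hx
    refine h3 (h.mono hR hS (fun s t hst => ?_) _ _ (by simpa using hx))
    obtain ⟨s', hs', rfl⟩ := hR' s t hst
    obtain ⟨i, rfl, rfl, hi⟩ := hφ' s' t hs'
    rw [← hi]
    exact hcb i

theorem eq_of_compat_self (h : Consistent m) {n : ℕ} {a : Fin n → Bool} {x y : Bool}
    (hc : Compat m a a x y) : x = y := by
  have h1 := hc 9 (by norm_num) fun i => by cases a i <;> rfl
  by_contra hxy
  have key : ∀ x y, ¬ x = y → axiomMask.testBit (4 * 9 + ix x y) = true := by decide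
  have h2 : m.testBit (4 * 9 + ix x y) = true := testBit_of_lor_eq h.1 (key x y hxy)
  rw [h2] at h1
  exact absurd h1 (by decide)

theorem compat_self_left (h : Consistent m) {n : ℕ} {a b : Fin n → Bool} {x y : Bool}
    (hc : Compat m a b x y) : Compat m a a x x := by
  obtain ⟨z, hz, -⟩ := h.exists_compat hc a
  rwa [← h.eq_of_compat_self hz] at hz

theorem compat_self_right (h : Consistent m) {n : ℕ} {a b : Fin n → Bool} {x y : Bool}
    (hc : Compat m a b x y) : Compat m b b y y := h.compat_self_left (h.compat_swap hc)

/-- Compatible values at two tuples are the values of a function in the class. The function is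
built by adding one tuple at a time. A new tuple can be given a value: otherwise each of the
two values is ruled out by a tuple that already has a value, and these two tuples together
contradict path consistency. -/
theorem exists_mem_avoiding (h : Consistent m) {n : ℕ+} {a₀ b₀ : Fin n → Bool} {x y : Bool}
    (hc : Compat m a₀ b₀ x y) :
    ∃ f : (Fin n → Bool) → Bool, (⟨n, f⟩ : BoolFun) ∈ avoiding m ∧ f a₀ = x ∧ f b₀ = y := by
  classical
  have key : ∀ S : Finset (Fin n → Bool), ∃ f : (Fin n → Bool) → Bool, f a₀ = x ∧ f b₀ = y ∧
      ∀ a b, (a ∈ insert a₀ (insert b₀ S)) → (b ∈ insert a₀ (insert b₀ S)) →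
        Compat m a b (f a) (f b) := by
    intro S
    induction S using Finset.induction_on with
    | empty =>
      refine ⟨fun c => if c = a₀ then x else y, if_pos rfl, ?_, ?_⟩
      · dsimp only
        split_ifs with hb
        · subst hb; exact h.eq_of_compat_self hc
        · rfl
      · have hb : (if b₀ = a₀ then x else y) = y := by
          split_ifs with hb
          · subst hb; exact h.eq_of_compat_self hc
          · rfl
        intro a b ha hb'
        simp only [insert_empty_eq, Finset.mem_insert, Finset.mem_singleton] at ha hb'
        rcases ha with rfl | rfl <;> rcases hb' with rfl | rfl <;> simp only [if_true, hb]
        exacts [h.compat_self_left hc, hc, h.compat_swap hc, h.compat_self_right hc]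
    | insert c S _ ih =>
      obtain ⟨f, hfa, hfb, hf⟩ := ih
      rw [Finset.insert_comm b₀, Finset.insert_comm a₀]
      by_cases hcS : c ∈ insert a₀ (insert b₀ S)
      · rw [Finset.insert_eq_self.2 hcS]
        exact ⟨f, hfa, hfb, hf⟩
      generalize hU : insert a₀ (insert b₀ S) = U at *
      have ha₀ : a₀ ∈ U := by simp [← hU]
      have hb₀ : b₀ ∈ U := by simp [← hU]
      obtain ⟨z, hz⟩ : ∃ z, ∀ a ∈ U, Compat m a c (f a) z := by
        by_contra! hcon
        obtain ⟨a, ha, hac⟩ := hcon false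
        obtain ⟨b, hb, hbc⟩ := hcon true
        obtain ⟨z, hz1, hz2⟩ := h.exists_compat (hf a b ha hb) c
        cases z
        · exact hac hz1
        · exact hbc (h.compat_swap hz2)
      have hne : ∀ a ∈ U, a ≠ c := fun a ha hac => hcS (hac ▸ ha)
      refine ⟨Function.update f c z, ?_, ?_, ?_⟩
      · rw [Function.update_of_ne (hne _ ha₀), hfa]
      · rw [Function.update_of_ne (hne _ hb₀), hfb]
      · intro a b ha hb
        rcases Finset.mem_insert.1 ha with ha | ha <;> rcases Finset.mem_insert.1 hb with hb | hb
        · rw [ha, hb, Function.update_self]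
          exact h.compat_self_right (hz _ ha₀)
        · rw [ha, Function.update_self, Function.update_of_ne (hne _ hb)]
          exact h.compat_swap (hz b hb)
        · rw [hb, Function.update_self, Function.update_of_ne (hne _ ha)]
          exact hz a ha
        · rw [Function.update_of_ne (hne _ hb), Function.update_of_ne (hne _ ha)]
          exact hf a b ha hb
  obtain ⟨f, hfa, hfb, hf⟩ := key Finset.univ
  exact ⟨f, fun T hT a b hab => hf a b (by simp) (by simp) T hT hab, hfa, hfb⟩

end Consistent

/-- Two tuples of length four whose columns are exactly the pairs in `T`. -/
theorem exists_tuples {T : ℕ} (hT : T < 16) (hT0 : T ≠ 0) :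
    ∃ a b : Fin (4 : ℕ+) → Bool, Cols T a b ∧
      ∀ s t, T.testBit (ix s t) = true → ∃ i, a i = s ∧ b i = t := by
  have key : ∀ T < 16, T ≠ 0 → ∃ s t, T.testBit (ix s t) = true := by decide +kernel
  obtain ⟨s₀, t₀, h₀⟩ := key T hT hT0
  let e : Fin (4 : ℕ+) → Bool × Bool := fun i => (i.val.testBit 1, i.val.testBit 0)
  have he : ∀ p, ∃ i, e i = p := by decide +kernel
  let g : Fin (4 : ℕ+) → Bool × Bool := fun i =>
    if T.testBit (ix (e i).1 (e i).2) then e i else (s₀, t₀)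
  refine ⟨fun i => (g i).1, fun i => (g i).2, fun i => ?_, fun s t hst => ?_⟩
  · by_cases hi : T.testBit (ix (e i).1 (e i).2) = true
    · simp only [g, if_pos hi, hi]
    · simp only [g, if_neg hi, h₀]
  · obtain ⟨i, hi⟩ := he (s, t)
    refine ⟨i, ?_⟩
    simp [g, hi, hst]

namespace Consistent

variable {m : ℕ}

/-- A value pair that is not forbidden on `T` occurs in the class, at two tuples that depend only
on `T`. -/
theorem exists_witness (h : Consistent m) {T : ℕ} (hT : T < 16) :
    ∃ a b : Fin (4 : ℕ+) → Bool, ∀ x y, m.testBit (4 * T + ix x y) = false → Cols T a b ∧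
      ∃ f : (Fin (4 : ℕ+) → Bool) → Bool,
        (⟨4, f⟩ : BoolFun) ∈ avoiding m ∧ f a = x ∧ f b = y := by
  by_cases hT0 : T = 0
  · subst hT0
    refine ⟨fun _ => true, fun _ => true, fun x y hx => ?_⟩
    have key : ∀ x y, axiomMask.testBit (4 * 0 + ix x y) = true := by decide
    rw [testBit_of_lor_eq h.1 (key x y)] at hx
    exact absurd hx (by decide)
  obtain ⟨a, b, hab, hT'⟩ := exists_tuples hT hT0
  refine ⟨a, b, fun x y hx => ⟨hab, h.exists_mem_avoiding fun S hS hS' => ?_⟩⟩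
  by_contra hx'
  rw [h.mono hT hS (fun s t hst => ?_) x y (by simpa using hx')] at hx
  · exact absurd hx (by decide)
  · obtain ⟨i, rfl, rfl⟩ := hT' s t hst
    exact hS' i

end Consistent

/-! ### Stable classes are determined by their forbidden pairs -/

/-- The mask that forbids only the value pair with number `k` on the relation `T`. -/
def bit (T k : ℕ) : ℕ := (1 <<< k) <<< (4 * T)

theorem mem_avoiding_bit {T : ℕ} (hT : T < 16) {x y : Bool} {f : BoolFun} :
    f ∈ avoiding (bit T (ix x y)) ↔ ∀ a b, Cols T a b → ¬(f.2 a = x ∧ f.2 b = y) := by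
  have key : ∀ x y, 1 <<< ix x y < 16 ∧ ∀ s t,
      ((1 <<< ix x y).testBit (ix s t) = false ↔ ¬(s = x ∧ t = y)) := by decide +kernel
  simp only [bit, mem_avoiding_shiftLeft (key x y).1 hT, (key x y).2]

theorem minor_mem {K : BoolClass} (hK : comp K clIc ⊆ K) {n m : ℕ+} {f : (Fin n → Bool) → Bool}
    (hf : (⟨n, f⟩ : BoolFun) ∈ K) (σ : Fin n → Fin m) :
    (⟨m, fun a => f fun i => a (σ i)⟩ : BoolFun) ∈ K :=
  hK ⟨n, m, f, fun i a => a (σ i), hf, fun i => ⟨m, σ i, rfl⟩, rfl⟩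

/-- The median of three Boolean values. -/
def median (x y z : Bool) : Bool := (x && y) || (x && z) || (y && z)

theorem median_mem_clSM : (⟨3, fun v => median (v 0) (v 1) (v 2)⟩ : BoolFun) ∈ clSM := by
  constructor
  · intro a
    simp only [barTuple]
    generalize a 0 = x, a 1 = y, a 2 = z
    revert x y z; decide
  · intro a b hab
    have key : ∀ x x' y y' z z' : Bool, x ≤ x' → y ≤ y' → z ≤ z' →
        median x y z ≤ median x' y' z' := by decide
    exact key _ _ _ _ _ _ (hab 0) (hab 1) (hab 2)

theorem comp_median_mem {K : BoolClass} (hK : comp clSM K ⊆ K) {m : ℕ+}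
    {f g h : (Fin m → Bool) → Bool} (hf : (⟨m, f⟩ : BoolFun) ∈ K) (hg : (⟨m, g⟩ : BoolFun) ∈ K)
    (hh : (⟨m, h⟩ : BoolFun) ∈ K) :
    (⟨m, fun a => median (f a) (g a) (h a)⟩ : BoolFun) ∈ K := by
  refine hK ⟨3, m, _, fun i : Fin 3 => ![f, g, h] i, median_mem_clSM, fun i : Fin 3 => ?_, rfl⟩
  fin_cases i
  exacts [hf, hg, hh]

/-- The argument of Baker and Pixley: a function whose restriction to any two points agrees with
a member of a stable class belongs to the class. A finite set with three points `a`, `b`, `c` is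
treated by the median of three members that agree with the function outside of `a`, outside of
`b`, and outside of `c`. -/
theorem mem_of_forall_pair {K : BoolClass} (hK : comp clSM K ⊆ K) {n : ℕ+}
    {f : (Fin n → Bool) → Bool}
    (h : ∀ a b, ∃ g, (⟨n, g⟩ : BoolFun) ∈ K ∧ g a = f a ∧ g b = f b) :
    (⟨n, f⟩ : BoolFun) ∈ K := by
  classical
  have key : ∀ S : Finset (Fin n → Bool), ∃ g, (⟨n, g⟩ : BoolFun) ∈ K ∧ ∀ a ∈ S, g a = f a := by
    intro S
    induction S using Finset.strongInduction with
    | H S ih =>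
      by_cases hS : 2 < S.card
      · obtain ⟨a, b, c, ha, hb, hc, hab, hac, hbc⟩ := Finset.two_lt_card_iff.1 hS
        obtain ⟨g₁, hg₁, h₁⟩ := ih _ (Finset.erase_ssubset ha)
        obtain ⟨g₂, hg₂, h₂⟩ := ih _ (Finset.erase_ssubset hb)
        obtain ⟨g₃, hg₃, h₃⟩ := ih _ (Finset.erase_ssubset hc)
        refine ⟨_, comp_median_mem hK hg₁ hg₂ hg₃, fun d hd => ?_⟩
        have m₁ : ∀ x z, median z x x = x := by decide
        have m₂ : ∀ x z, median x z x = x := by decide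
        have m₃ : ∀ x z, median x x z = x := by decide
        by_cases hda : d = a
        · subst hda
          rw [h₂ d (Finset.mem_erase.2 ⟨hab, hd⟩), h₃ d (Finset.mem_erase.2 ⟨hac, hd⟩), m₁]
        by_cases hdb : d = b
        · subst hdb
          rw [h₁ d (Finset.mem_erase.2 ⟨hda, hd⟩), h₃ d (Finset.mem_erase.2 ⟨hbc, hd⟩), m₂]
        · rw [h₁ d (Finset.mem_erase.2 ⟨hda, hd⟩), h₂ d (Finset.mem_erase.2 ⟨hdb, hd⟩), m₃]
      · obtain ⟨a, b, hab⟩ : ∃ a b, S ⊆ {a, b} := by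
          rcases Nat.lt_or_ge S.card 2 with h1 | h1
          · obtain ⟨a, ha⟩ := Finset.card_le_one_iff_subset_singleton.1 (Nat.lt_succ_iff.1 h1)
            exact ⟨a, a, ha.trans (by simp)⟩
          · obtain ⟨a, b, -, rfl⟩ := Finset.card_eq_two.1 (le_antisymm (not_lt.1 hS) h1)
            exact ⟨a, b, subset_rfl⟩
        obtain ⟨g, hg, hga, hgb⟩ := h a b
        refine ⟨g, hg, fun d hd => ?_⟩
        rcases Finset.mem_insert.1 (hab hd) with rfl | hd
        · exact hga
        · rw [Finset.mem_singleton.1 hd, hgb]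
  obtain ⟨g, hg, hgf⟩ := key Finset.univ
  rwa [show g = f from funext fun a => hgf a (Finset.mem_univ a)] at hg

theorem mem_of_stable {K : BoolClass} (hK : IsStable clIc clSM K) {f : BoolFun}
    (hf : ∀ T < 16, ∀ x y, K ⊆ avoiding (bit T (ix x y)) → f ∈ avoiding (bit T (ix x y))) :
    f ∈ K := by
  obtain ⟨n, f⟩ := f
  refine mem_of_forall_pair hK.2 fun a b => ?_
  obtain ⟨T, hT, hcols⟩ := exists_cols a b
  have h1 : ¬ K ⊆ avoiding (bit T (ix (f a) (f b))) := fun h =>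
    (mem_avoiding_bit hT).1 (hf T hT _ _ h) a b (fun i => (hcols _ _).2 ⟨i, rfl, rfl⟩) ⟨rfl, rfl⟩
  obtain ⟨⟨k, g⟩, hg, hg'⟩ := Set.not_subset.1 h1
  rw [mem_avoiding_bit hT] at hg'
  push Not at hg'
  obtain ⟨a', b', hab', h2, h3⟩ := hg'
  -- every column of `a'`, `b'` is a column of `a`, `b`, so `g` has a minor with the right values
  choose σ hσa hσb using fun j => (hcols _ _).1 (hab' j)
  exact ⟨_, minor_mem hK.1 hg σ, by simpa only [hσa] using h2, by simpa only [hσb] using h3⟩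

/-! ### Composition from the left and from the right -/

/-- Functions that are self-dual and monotone attain on two tuples a pair of values that is already
one of the columns. -/
theorem exists_coord_of_mem_clSM {f : BoolFun} (hf : f ∈ clSM) (a b : Fin f.1 → Bool) :
    ∃ i, a i = f.2 a ∧ b i = f.2 b := by
  have key : ∀ a b : Fin f.1 → Bool, (∀ i, ¬(a i = f.2 a ∧ b i = f.2 b)) → f.2 a = true →
      False := by
    intro a b h hfa
    rw [hfa] at h
    cases hfb : f.2 b <;> rw [hfb] at h
    · have k : ∀ s t : Bool, ¬(s = true ∧ t = false) → s ≤ t := by decide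
      have := hf.2 a b fun i => k _ _ (h i)
      rw [hfa, hfb] at this
      exact absurd this (by decide)
    · have k : ∀ s t : Bool, ¬(s = true ∧ t = true) → s ≤ !t := by decide
      have := hf.2 a (barTuple b) fun i => k _ _ (h i)
      rw [hf.1 b] at hfb
      rw [hfa] at this
      revert this hfb; cases f.2 (barTuple b) <;> decide
  by_contra! h
  cases hfa : f.2 a
  · have h1 : f.2 (barTuple a) = true := by
      have := hf.1 a
      rw [hfa] at this
      simpa using this.symm
    have h2 : f.2 (barTuple b) = !f.2 b := by
      rw [hf.1 b, Bool.not_not]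
    refine key (barTuple a) (barTuple b) (fun i hi => ?_) h1
    rw [h1, h2] at hi
    refine h i ?_ ?_
    · rw [hfa]; simpa [barTuple] using hi.1
    · simpa [barTuple] using hi.2
  · exact key a b (fun i hi => h i hi.1 hi.2) hfa

theorem clSM_subset_pol (R : ℕ) : clSM ⊆ pol R := by
  intro f hf a b hab
  obtain ⟨i, h1, h2⟩ := exists_coord_of_mem_clSM hf a b
  rw [← h1, ← h2]
  exact hab i

theorem isClone_pol (P : ℕ → Prop) : IsClone {f : BoolFun | ∀ R, P R → f ∈ pol R} := by
  constructor
  · rintro f ⟨n, i, rfl⟩ R _ a b hab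
    exact hab i
  · rintro f ⟨n, m, f, g, hf, hg, rfl⟩ R hR a b hab
    exact hf R hR _ _ fun i => hg i R hR a b hab

/-- The relation `T` cannot be enlarged without making more value pairs possible. -/
def closedRel (m T : ℕ) : Bool :=
  [0, 1, 2, 3].all fun k => T.testBit k || nib m (T ||| 1 <<< k) != nib m T

/-- The functions that preserve each relation of possible value pairs. -/
def leftClone (m : ℕ) : BoolClass := {f | ∀ R, (∃ T < 16, R = 15 - nib m T) → f ∈ pol R}

/-- The functions that preserve each relation that cannot be enlarged without making more value
pairs possible. -/
def rightClone (m : ℕ) : BoolClass := {f | ∀ T, (T < 16 ∧ closedRel m T = true) → f ∈ pol T}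

theorem comp_subset_of_subset_leftClone {m : ℕ} {C : BoolClass} (hC : C ⊆ leftClone m) :
    comp C (avoiding m) ⊆ avoiding m := by
  rintro _ ⟨n, k, f, g, hf, hg, rfl⟩ T hT a b hab
  have h1 := hC hf _ ⟨T, hT, rfl⟩ (fun i => g i a) (fun i => g i b) fun i => by
    rw [compl_testBit (nib_lt _ _), nib_testBit, hg i T hT a b hab]
    rfl
  rw [compl_testBit (nib_lt _ _), nib_testBit] at h1
  simpa using h1

theorem isStable_avoiding (m : ℕ) : IsStable clIc clSM (avoiding m) := by
  constructor
  · rintro _ ⟨n, k, f, g, hf, hg, rfl⟩ T hT a b hab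
    refine hf T hT _ _ fun i => ?_
    obtain ⟨k', j, hj⟩ := hg i
    obtain ⟨rfl, hj⟩ := Sigma.mk.inj hj
    rw [eq_of_heq hj]
    exact hab j
  · exact comp_subset_of_subset_leftClone fun f hf R _ => clSM_subset_pol R hf

namespace Consistent

variable {m : ℕ}

theorem comp_subset_iff_left (h : Consistent m) (C : BoolClass) :
    comp C (avoiding m) ⊆ avoiding m ↔ C ⊆ leftClone m := by
  refine ⟨?_, comp_subset_of_subset_leftClone⟩
  rintro hC ⟨n, f⟩ hf _ ⟨T, hT, rfl⟩ u v huv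
  obtain ⟨a, b, hab⟩ := h.exists_witness hT
  have h1 : ∀ i, m.testBit (4 * T + ix (u i) (v i)) = false := fun i => by
    have := huv i
    rw [compl_testBit (nib_lt _ _), nib_testBit] at this
    simpa using this
  choose hcols g hg hga hgb using fun i => hab _ _ (h1 i)
  have h2 := hC ⟨n, 4, f, g, hf, hg, rfl⟩ T hT a b (hcols ⟨0, n.pos⟩)
  simp only [hga, hgb] at h2
  rw [compl_testBit (nib_lt _ _), nib_testBit, h2]
  rfl

/-- Every relation is contained in a closed relation with the same possible value pairs. -/
theorem exists_closedRel (m : ℕ) {T : ℕ} (hT : T < 16) : ∃ S < 16, closedRel m S = true ∧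
    nib m S = nib m T ∧ ∀ s t, T.testBit (ix s t) = true → S.testBit (ix s t) = true := by
  let F := (Finset.range 16).filter fun S =>
    nib m S = nib m T ∧ ∀ s t, T.testBit (ix s t) = true → S.testBit (ix s t) = true
  have hF : F.Nonempty := ⟨T, by simp [F, hT]⟩
  obtain ⟨S, hS, hmax⟩ := F.exists_max_image id hF
  simp only [F, Finset.mem_filter, Finset.mem_range, id_eq] at hS hmax
  refine ⟨S, hS.1, ?_, hS.2.1, hS.2.2⟩
  have key : ∀ S < 16, ∀ k ∈ [0, 1, 2, 3], S.testBit k = true ∨ (S ||| 1 <<< k < 16 ∧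
      S < S ||| 1 <<< k ∧
      ∀ s t, S.testBit (ix s t) = true → (S ||| 1 <<< k).testBit (ix s t) = true) := by
    decide +kernel
  refine List.all_eq_true.2 fun k hk => ?_
  rw [Bool.or_eq_true, bne_iff_ne]
  refine (key S hS.1 k hk).imp id fun hk' hnib => ?_
  exact absurd (hmax _ ⟨hk'.1, hnib.trans hS.2.1, fun s t hst => hk'.2.2 s t (hS.2.2 s t hst)⟩)
    (not_le.2 hk'.2.1)

/-- If `f` does not preserve the closed relation `T`, then it maps columns in `T` to some `p`
outside of `T`, and some function `h` of the class attains on `T ∪ {p}` a value pair that is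
forbidden on `T`. Substituting `f` and projections into `h` gives a function that attains this
pair on `T`. -/
theorem comp_subset_iff_right (h : Consistent m) {C : BoolClass} (hCl : IsClone C) :
    comp (avoiding m) C ⊆ avoiding m ↔ C ⊆ rightClone m := by
  constructor
  · rintro hC ⟨n, f⟩ hf T ⟨hT, hclosed⟩ a b hab
    by_contra hfab
    dsimp only at hfab
    have hk : ix (f a) (f b) ∈ [0, 1, 2, 3] := by cases f a <;> cases f b <;> decide
    have h1 := List.all_eq_true.1 hclosed _ hk
    rw [Bool.or_eq_true, or_iff_right hfab, bne_iff_ne] at h1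
    have key : ∀ x y, ∀ T < 16, (T ||| 1 <<< ix x y) < 16 ∧
        (∀ s t, (T ||| 1 <<< ix x y).testBit (ix s t) = true ↔
          T.testBit (ix s t) = true ∨ (s = x ∧ t = y)) := by decide +kernel
    obtain ⟨hT', hspec⟩ := key (f a) (f b) T hT
    generalize T ||| 1 <<< ix (f a) (f b) = T' at *
    obtain ⟨x, y, hx', hx⟩ : ∃ x y, m.testBit (4 * T' + ix x y) = false ∧
        m.testBit (4 * T + ix x y) = true := by
      by_contra! hcon
      refine h1 (testBit_eq_of_lt_16 (nib_lt _ _) (nib_lt _ _) fun x y => ?_)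
      rw [nib_testBit, nib_testBit]
      cases h2 : m.testBit (4 * T' + ix x y)
      · exact (by simpa using hcon x y h2 : _ = false).symm
      · exact (h.mono hT hT' (fun s t hst => (hspec s t).2 (Or.inl hst)) x y h2).symm
    obtain ⟨a', b', hab'⟩ := h.exists_witness hT'
    obtain ⟨hcols, g, hg, hga, hgb⟩ := hab' x y hx'
    -- append to the columns of `a`, `b` the columns of `a'`, `b'` that belong to `T`
    let i₀ : Fin n := ⟨0, n.pos⟩
    let inT : Fin (4 : ℕ+) → Prop := fun j => T.testBit (ix (a' j) (b' j)) = true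
    let A : Fin (n + 4 : ℕ+) → Bool :=
      Fin.append a fun j : Fin (4 : ℕ+) => if inT j then a' j else a i₀
    let B : Fin (n + 4 : ℕ+) → Bool :=
      Fin.append b fun j : Fin (4 : ℕ+) => if inT j then b' j else b i₀
    let l : Fin n → Fin (n + 4 : ℕ+) := Fin.castAdd 4
    let r : Fin (4 : ℕ+) → Fin (n + 4 : ℕ+) := Fin.natAdd n
    have hAl : ∀ i, A (l i) = a i := fun i => Fin.append_left _ _ i
    have hBl : ∀ i, B (l i) = b i := fun i => Fin.append_left _ _ i
    have hAr : ∀ j, A (r j) = if inT j then a' j else a i₀ := fun j => Fin.append_right _ _ j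
    have hBr : ∀ j, B (r j) = if inT j then b' j else b i₀ := fun j => Fin.append_right _ _ j
    have hAB : Cols T A B := by
      refine Fin.addCases (m := n) (n := (4 : ℕ+)) (fun i => ?_) fun j => ?_
      · change T.testBit (ix (A (l i)) (B (l i))) = true
        rw [hAl, hBl]
        exact hab i
      · change T.testBit (ix (A (r j)) (B (r j))) = true
        rw [hAr, hBr]
        split_ifs with hj
        · exact hj
        · exact hab i₀
    have hmem : ∀ j, ∃ q : (Fin (n + 4 : ℕ+) → Bool) → Bool,
        (⟨n + 4, q⟩ : BoolFun) ∈ C ∧ q A = a' j ∧ q B = b' j := by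
      intro j
      by_cases hj : inT j
      · exact ⟨fun c => c (r j), hCl.1 ⟨_, _, rfl⟩, (hAr j).trans (if_pos hj),
          (hBr j).trans (if_pos hj)⟩
      · refine ⟨fun c => f fun i => c (l i),
          hCl.2 ⟨n, n + 4, f, fun i c => c (l i), hf, fun i => hCl.1 ⟨_, _, rfl⟩, rfl⟩, ?_⟩
        simp only [hAl, hBl]
        have := (hspec _ _).1 (hcols j)
        exact ⟨(this.resolve_left hj).1.symm, (this.resolve_left hj).2.symm⟩
    choose q hq hqA hqB using hmem
    have h2 := hC ⟨4, n + 4, g, q, hg, hq, rfl⟩ T hT A B hAB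
    simp only [hqA, hqB, hga, hgb, hx] at h2
    exact absurd h2 (by decide)
  · rintro hC _ ⟨n, k, f, g, hf, hg, rfl⟩ T hT a b hab
    obtain ⟨S, hS, hclosed, hnib, hTS⟩ := exists_closedRel m hT
    have h1 := hf S hS _ _ fun i => hC (hg i) S ⟨hS, hclosed⟩ a b (hab.mono hTS)
    rwa [← nib_testBit, hnib, nib_testBit] at h1

end Consistent

/-- The union of a list of masks. -/
def orAll (l : List ℕ) : ℕ := l.foldr (· ||| ·) 0

theorem mem_avoiding_orAll {l : List ℕ} {f : BoolFun} :
    f ∈ avoiding (orAll l) ↔ ∀ d ∈ l, f ∈ avoiding d := by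
  induction l with
  | nil => simp [orAll, avoiding_zero, clAll]
  | cons d l ih =>
    rw [List.forall_mem_cons, ← ih]
    exact Set.ext_iff.1 (avoiding_lor d (orAll l)) f

/-- A mask for `leftClone`. -/
def leftMask (m : ℕ) : ℕ := orAll ((List.range 16).map fun T => polMask (15 - nib m T))

/-- A mask for `rightClone`. -/
def rightMask (m : ℕ) : ℕ :=
  orAll (((List.range 16).filter fun T => closedRel m T).map polMask)

theorem avoiding_leftMask (m : ℕ) : avoiding (leftMask m) = leftClone m := by
  ext f
  simp only [leftMask, mem_avoiding_orAll, List.forall_mem_map, List.mem_range, leftClone,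
    Set.mem_ofPred_eq, forall_exists_index, and_imp]
  refine ⟨?_, fun h T hT => ?_⟩
  · rintro h _ T hT rfl
    rw [← avoiding_polMask (by omega)]
    exact h T hT
  · rw [avoiding_polMask (by omega)]
    exact h _ T hT rfl

theorem avoiding_rightMask (m : ℕ) : avoiding (rightMask m) = rightClone m := by
  ext f
  simp only [rightMask, mem_avoiding_orAll, List.forall_mem_map, List.mem_filter, List.mem_range,
    rightClone, Set.mem_ofPred_eq]
  refine forall₂_congr fun T hT => ?_
  rw [avoiding_polMask hT.1]

/-! ### Masks of the basic classes -/

section ColumnRelations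

variable {n : ℕ} {a b : Fin n → Bool}

theorem cols_one : Cols 1 a b ↔ a = (fun _ => false) ∧ b = fun _ => false := by
  have key : ∀ s t, Nat.testBit 1 (ix s t) = true ↔ s = false ∧ t = false := by decide
  simp only [Cols, key, forall_and, funext_iff]

theorem cols_two : Cols 2 a b ↔ a = (fun _ => false) ∧ b = fun _ => true := by
  have key : ∀ s t, Nat.testBit 2 (ix s t) = true ↔ s = false ∧ t = true := by decide
  simp only [Cols, key, forall_and, funext_iff]

theorem cols_three : Cols 3 a b ↔ a = fun _ => false := by
  have key : ∀ s t, Nat.testBit 3 (ix s t) = true ↔ s = false := by decide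
  simp only [Cols, key, funext_iff]

theorem cols_six : Cols 6 a b ↔ b = barTuple a := by
  have key : ∀ s t, Nat.testBit 6 (ix s t) = true ↔ t = !s := by decide
  simp only [Cols, key, funext_iff, barTuple]

theorem cols_seven : Cols 7 a b ↔ a ⊓ b = ⊥ := by
  have key : ∀ s t, Nat.testBit 7 (ix s t) = true ↔ s ⊓ t = ⊥ := by decide
  simp only [Cols, key, funext_iff, Pi.inf_apply, Pi.bot_apply]

theorem cols_eight : Cols 8 a b ↔ a = (fun _ => true) ∧ b = fun _ => true := by
  have key : ∀ s t, Nat.testBit 8 (ix s t) = true ↔ s = true ∧ t = true := by decide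
  simp only [Cols, key, forall_and, funext_iff]

theorem cols_nine : Cols 9 a b ↔ a = b := by
  have key : ∀ s t, Nat.testBit 9 (ix s t) = true ↔ s = t := by decide
  simp only [Cols, key, funext_iff]

theorem cols_ten : Cols 10 a b ↔ b = fun _ => true := by
  have key : ∀ s t, Nat.testBit 10 (ix s t) = true ↔ t = true := by decide
  simp only [Cols, key, funext_iff]

theorem cols_eleven : Cols 11 a b ↔ a ≤ b := by
  have key : ∀ s t, Nat.testBit 11 (ix s t) = true ↔ s ≤ t := by decide
  simp only [Cols, key, Pi.le_def]

theorem cols_fourteen : Cols 14 a b ↔ a ⊔ b = ⊤ := by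
  have key : ∀ s t, Nat.testBit 14 (ix s t) = true ↔ s ⊔ t = ⊤ := by decide
  simp only [Cols, key, funext_iff, Pi.sup_apply, Pi.top_apply]

theorem cols_fifteen : Cols 15 a b := by
  have key : ∀ s t, Nat.testBit 15 (ix s t) = true := by decide
  exact fun i => key _ _

end ColumnRelations

/-- `f(0) = a`. -/
def mVal0 (a : Bool) : ℕ := bit 1 (ix (!a) (!a))
/-- `f(1) = a`. -/
def mVal1 (a : Bool) : ℕ := bit 8 (ix (!a) (!a))
/-- `f(0) = a` and `f(1) = b`. -/
def mVal (a b : Bool) : ℕ := mVal0 a ||| mVal1 b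
/-- `f(0) = f(1)`. -/
def mEq : ℕ := bit 2 (ix false true) ||| bit 2 (ix true false)
/-- `f(0) ≠ f(1)`. -/
def mNe : ℕ := bit 2 (ix false false) ||| bit 2 (ix true true)
/-- `f(0) ≤ f(1)`. -/
def mLe : ℕ := bit 2 (ix true false)
/-- `f(0) ≥ f(1)`. -/
def mGe : ℕ := bit 2 (ix false true)
/-- `f(0) = 0` or `f(1) = 0`. -/
def mNe00 : ℕ := bit 2 (ix true true)
/-- `f(0) = 1` or `f(1) = 1`. -/
def mNe11 : ℕ := bit 2 (ix false false)
/-- Reflexive functions. -/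
def mR : ℕ := bit 6 (ix true false)
/-- Minorants of self-dual functions. -/
def mSmin : ℕ := bit 6 (ix true true)
/-- Majorants of self-dual functions. -/
def mSmaj : ℕ := bit 6 (ix false false)
/-- Self-dual functions. -/
def mS : ℕ := mSmin ||| mSmaj
/-- Monotone functions. -/
def mM : ℕ := bit 11 (ix true false)
/-- The class `U`. -/
def mU : ℕ := bit 7 (ix true true)
/-- The class `W`. -/
def mW : ℕ := bit 14 (ix false false)
/-- Constant functions. -/
def mC : ℕ := bit 15 (ix true false)
/-- `f(0) = a` or `f` is constant. -/
def mVal0C (a : Bool) : ℕ := bit 3 (ix (!a) a)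
/-- `f(1) = a` or `f` is constant. -/
def mVal1C (a : Bool) : ℕ := bit 10 (ix a (!a))

theorem clAll_eq : clAll = avoiding 0 := avoiding_zero.symm

theorem empty_eq : (∅ : BoolClass) =
    avoiding (bit 9 (ix false false) ||| bit 9 (ix true true)) := by
  ext f
  rw [avoiding_lor, Set.mem_inter_iff, mem_avoiding_bit (by decide), mem_avoiding_bit (by decide)]
  simp only [cols_nine, Set.mem_empty_iff_false, false_iff]
  rintro ⟨h1, h2⟩
  have h1 := h1 ⊥ ⊥ rfl
  have h2 := h2 ⊥ ⊥ rfl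
  revert h1 h2
  cases f.2 ⊥ <;> simp

theorem mem_avoiding_mVal0 {a : Bool} {f : BoolFun} : f ∈ avoiding (mVal0 a) ↔ atZero f = a := by
  rw [mVal0, mem_avoiding_bit (by decide)]
  simp only [cols_one, and_imp, forall_eq_apply_imp_iff, forall_eq, and_self, atZero]
  cases a <;> simp

theorem mem_avoiding_mVal1 {a : Bool} {f : BoolFun} : f ∈ avoiding (mVal1 a) ↔ atOne f = a := by
  rw [mVal1, mem_avoiding_bit (by decide)]
  simp only [cols_eight, and_imp, forall_eq_apply_imp_iff, forall_eq, and_self, atOne]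
  cases a <;> simp

theorem mem_avoiding_bit_two {x y : Bool} {f : BoolFun} :
    f ∈ avoiding (bit 2 (ix x y)) ↔ ¬(atZero f = x ∧ atOne f = y) := by
  rw [mem_avoiding_bit (by decide)]
  simp only [cols_two, and_imp, forall_eq_apply_imp_iff, forall_eq, atOne, atZero]

theorem mem_avoiding_mVal0C {a : Bool} {f : BoolFun} :
    f ∈ avoiding (mVal0C a) ↔ (atZero f = !a → ∀ v, f.2 v = !a) := by
  rw [mVal0C, mem_avoiding_bit (by decide)]
  simp only [cols_three, atZero, not_and]
  refine ⟨fun h h0 v => Bool.eq_not.2 (h _ v rfl h0), ?_⟩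
  rintro h _ v rfl h0
  exact Bool.eq_not.1 (h h0 v)

theorem mem_avoiding_mVal1C {a : Bool} {f : BoolFun} :
    f ∈ avoiding (mVal1C a) ↔ (atOne f = !a → ∀ v, f.2 v = !a) := by
  rw [mVal1C, mem_avoiding_bit (by decide)]
  simp only [cols_ten, forall_eq, atOne, not_and']
  refine ⟨fun h h0 v => ?_, fun h v h0 => ?_⟩
  · exact (Bool.eq_not).2 (h v h0)
  · exact (Bool.eq_not).1 (h h0 v)

theorem val0_eq (K : BoolClass) (a : Bool) : val0 K a = K ∩ avoiding (mVal0 a) := by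
  ext f; simp only [val0, Set.mem_inter_iff, mem_avoiding_mVal0]; rfl

theorem val1_eq (K : BoolClass) (a : Bool) : val1 K a = K ∩ avoiding (mVal1 a) := by
  ext f; simp only [val1, Set.mem_inter_iff, mem_avoiding_mVal1]; rfl

theorem val_eq (K : BoolClass) (a b : Bool) : val K a b = K ∩ avoiding (mVal a b) := by
  rw [val, val0_eq, val1_eq, mVal, avoiding_lor, ← Set.inter_inter_distrib_left]

theorem valEq_eq (K : BoolClass) : valEq K = K ∩ avoiding mEq := by
  ext f
  simp only [valEq, mEq, avoiding_lor, Set.mem_inter_iff, mem_avoiding_bit_two, Set.mem_ofPred_eq]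
  cases atZero f <;> cases atOne f <;> simp

theorem valNe_eq (K : BoolClass) : valNe K = K ∩ avoiding mNe := by
  ext f
  simp only [valNe, mNe, avoiding_lor, Set.mem_inter_iff, mem_avoiding_bit_two, Set.mem_ofPred_eq]
  cases atZero f <;> cases atOne f <;> simp

theorem valLe_eq (K : BoolClass) : valLe K = K ∩ avoiding mLe := by
  ext f
  simp only [valLe, mLe, Set.mem_inter_iff, mem_avoiding_bit_two, Set.mem_ofPred_eq]
  cases atZero f <;> cases atOne f <;> simp

theorem valGe_eq (K : BoolClass) : valGe K = K ∩ avoiding mGe := by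
  ext f
  simp only [valGe, mGe, Set.mem_inter_iff, mem_avoiding_bit_two, Set.mem_ofPred_eq]
  cases atZero f <;> cases atOne f <;> simp

theorem valNe00_eq (K : BoolClass) : valNe00 K = K ∩ avoiding mNe00 := by
  ext f
  simp only [valNe00, valNe, val, val0, val1, mNe00, Set.mem_inter_iff, Set.mem_union,
    mem_avoiding_bit_two, Set.mem_ofPred_eq]
  cases atZero f <;> cases atOne f <;> simp

theorem valNe11_eq (K : BoolClass) : valNe11 K = K ∩ avoiding mNe11 := by
  ext f
  simp only [valNe11, valNe, val, val0, val1, mNe11, Set.mem_inter_iff, Set.mem_union,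
    mem_avoiding_bit_two, Set.mem_ofPred_eq]
  cases atZero f <;> cases atOne f <;> simp

theorem barTuple_barTuple {n : ℕ} (a : Fin n → Bool) : barTuple (barTuple a) = a :=
  funext fun i => Bool.not_not (a i)

theorem mem_avoiding_bit_six {x y : Bool} {f : BoolFun} :
    f ∈ avoiding (bit 6 (ix x y)) ↔ ∀ a, ¬(f.2 a = x ∧ f.2 (barTuple a) = y) := by
  rw [mem_avoiding_bit (by decide)]
  simp only [cols_six, forall_eq]

theorem clRefl_eq : clRefl = avoiding mR := by
  ext f
  rw [mR, mem_avoiding_bit_six]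
  refine ⟨fun h a => ?_, fun h a => ?_⟩
  · rw [← h a]; cases f.2 a <;> simp
  · have h1 := h a
    have h2 := h (barTuple a)
    rw [barTuple_barTuple] at h2
    revert h1 h2
    cases f.2 a <;> cases f.2 (barTuple a) <;> simp

theorem clS_eq : clS = avoiding mS := by
  ext f
  simp only [mS, mSmin, mSmaj, avoiding_lor, Set.mem_inter_iff, mem_avoiding_bit_six, ← forall_and]
  refine forall_congr' fun a => ?_
  cases f.2 a <;> cases f.2 (barTuple a) <;> simp

/-- Where `f` takes different values at a tuple and its complement, keep the values of `f`; elsewhere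
take the value of the first coordinate. -/
theorem self_dual_extension_mem {n : ℕ+} (f : (Fin n → Bool) → Bool) :
    (⟨n, fun a => if f a = f (barTuple a) then a ⟨0, n.pos⟩ else f a⟩ : BoolFun) ∈ clS := by
  intro a
  have key : ∀ u v x : Bool, (if u = v then x else u) = !(if v = u then !x else v) := by decide
  change (if f a = f (barTuple a) then a ⟨0, n.pos⟩ else f a) =
    !(if f (barTuple a) = f (barTuple (barTuple a)) then !(a ⟨0, n.pos⟩) else f (barTuple a))
  rw [barTuple_barTuple]
  exact key _ _ _

theorem clSmin_eq : clSmin = avoiding mSmin := by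
  ext f
  rw [mSmin, mem_avoiding_bit_six]
  refine ⟨?_, fun h => ⟨_, self_dual_extension_mem f.2, fun a => ?_⟩⟩
  · rintro ⟨g, hg, hfg⟩ a ⟨h1, h2⟩
    have h3 := hfg a
    have h4 := hfg (barTuple a)
    have h5 : g a = !(g (barTuple a)) := hg a
    rw [h1, h5] at h3
    rw [h2] at h4
    revert h3 h4
    cases g (barTuple a) <;> decide
  · have h1 := h a
    revert h1
    cases h2 : f.2 a <;> cases f.2 (barTuple a) <;> simp

theorem clSmaj_eq : clSmaj = avoiding mSmaj := by
  ext f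
  rw [mSmaj, mem_avoiding_bit_six]
  refine ⟨?_, fun h => ⟨_, self_dual_extension_mem f.2, fun a => ?_⟩⟩
  · rintro ⟨g, hg, hfg⟩ a ⟨h1, h2⟩
    have h3 := hfg a
    have h4 := hfg (barTuple a)
    have h5 : g a = !(g (barTuple a)) := hg a
    rw [h1, h5] at h3
    rw [h2] at h4
    revert h3 h4
    cases g (barTuple a) <;> decide
  · have h1 := h a
    revert h1
    cases h2 : f.2 a <;> cases f.2 (barTuple a) <;> simp

theorem clM_eq : clM = avoiding mM := by
  ext f
  rw [mM, mem_avoiding_bit (by decide)]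
  simp only [cols_eleven]
  refine forall₃_congr fun a b _ => ?_
  cases f.2 a <;> cases f.2 b <;> simp

theorem clU_eq : clU = avoiding mU := by
  ext f
  rw [mU, mem_avoiding_bit (by decide)]
  simp only [cols_seven]
  refine forall₂_congr fun a b => ?_
  tauto

theorem clW_eq : clW = avoiding mW := by
  ext f
  rw [mW, mem_avoiding_bit (by decide)]
  simp only [cols_fourteen]
  refine forall₂_congr fun a b => ?_
  tauto

theorem clC_eq : clC = avoiding mC := by
  ext f
  rw [mC, mem_avoiding_bit (by decide)]
  simp only [cols_fifteen, forall_const]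
  refine ⟨?_, fun h => ⟨atZero f, fun a => ?_⟩⟩
  · rintro ⟨c, hc⟩ a b
    rw [hc a, hc b]
    cases c <;> simp
  · have h1 := h a (fun _ => false)
    have h2 := h (fun _ => false) a
    revert h1 h2
    simp only [atZero]
    cases f.2 a <;> cases f.2 fun _ => false <;> simp

theorem clC_iff_of_atZero {f : BoolFun} : f ∈ clC ↔ ∀ a, f.2 a = atZero f :=
  ⟨fun ⟨_, hc⟩ a => (hc a).trans (hc _).symm, fun h => ⟨_, h⟩⟩

theorem clC_iff_of_atOne {f : BoolFun} : f ∈ clC ↔ ∀ a, f.2 a = atOne f :=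
  ⟨fun ⟨_, hc⟩ a => (hc a).trans (hc _).symm, fun h => ⟨_, h⟩⟩

theorem val0_union_clC (a : Bool) : val0 clAll a ∪ clC = avoiding (mVal0C a) := by
  ext f
  rw [mem_avoiding_mVal0C, val0_eq, clAll, Set.univ_inter, Set.mem_union, mem_avoiding_mVal0,
    clC_iff_of_atZero, Bool.eq_not, ← or_iff_not_imp_left]
  refine or_congr_right' fun h => ?_
  rw [Bool.eq_not.2 h]

theorem val1_union_clC (a : Bool) : val1 clAll a ∪ clC = avoiding (mVal1C a) := by
  ext f
  rw [mem_avoiding_mVal1C, val1_eq, clAll, Set.univ_inter, Set.mem_union, mem_avoiding_mVal1,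
    clC_iff_of_atOne, Bool.eq_not, ← or_iff_not_imp_left]
  refine or_congr_right' fun h => ?_
  rw [Bool.eq_not.2 h]

theorem val_eq_inter (K : BoolClass) (a b : Bool) :
    val K a b = K ∩ (val0 clAll a ∩ val1 clAll b) := by
  rw [val_eq, val0_eq, val1_eq, clAll, Set.univ_inter, Set.univ_inter, mVal, avoiding_lor]

theorem val_union_clC {K : BoolClass} (h : clC ⊆ K) (a b : Bool) :
    val K a b ∪ clC = K ∩ avoiding (mVal0C a ||| mVal1C b) := by
  rw [val_eq_inter, Set.inter_union_distrib_right, Set.inter_union_distrib_right, val0_union_clC,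
    val1_union_clC, Set.union_eq_left.2 h, avoiding_lor]

/-- The union with the constants of value `c`, when `c` is the value prescribed at `0`. -/
theorem val_union_const_left {K : BoolClass} {c : Bool} (h : val clC c c ⊆ K) :
    val K c (!c) ∪ val clC c c = K ∩ avoiding (mVal0 c ||| mVal1C (!c)) := by
  have h0 : val clC c c ⊆ val0 clAll c := fun f hf => ⟨trivial, hf.1.2⟩
  have h1 : val1 clAll (!c) ∪ val clC c c = val1 clAll (!c) ∪ clC := by
    refine subset_antisymm (Set.union_subset_union_right _ fun f hf => hf.1.1) ?_
    refine Set.union_subset Set.subset_union_left fun f hf => ?_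
    by_cases h2 : atOne f = c
    · refine Or.inr ⟨⟨hf, ?_⟩, hf, h2⟩
      rw [← h2]; exact clC_iff_of_atOne.1 hf _
    · exact Or.inl ⟨trivial, Bool.eq_not.2 h2⟩
  rw [val_eq_inter, Set.inter_union_distrib_right, Set.inter_union_distrib_right, h1,
    val1_union_clC, Set.union_eq_left.2 h, Set.union_eq_left.2 h0, avoiding_lor, val0_eq, clAll,
    Set.univ_inter]

/-- The union with the constants of value `c`, when `c` is the value prescribed at `1`. -/
theorem val_union_const_right {K : BoolClass} {c : Bool} (h : val clC c c ⊆ K) :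
    val K (!c) c ∪ val clC c c = K ∩ avoiding (mVal0C (!c) ||| mVal1 c) := by
  have h0 : val clC c c ⊆ val1 clAll c := fun f hf => ⟨trivial, hf.2.2⟩
  have h1 : val0 clAll (!c) ∪ val clC c c = val0 clAll (!c) ∪ clC := by
    refine subset_antisymm (Set.union_subset_union_right _ fun f hf => hf.1.1) ?_
    refine Set.union_subset Set.subset_union_left fun f hf => ?_
    by_cases h2 : atZero f = c
    · refine Or.inr ⟨⟨hf, h2⟩, hf, ?_⟩
      rw [← h2]; exact clC_iff_of_atZero.1 hf _
    · exact Or.inl ⟨trivial, Bool.eq_not.2 h2⟩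
  rw [val_eq_inter, Set.inter_union_distrib_right, Set.inter_union_distrib_right, h1,
    val0_union_clC, Set.union_eq_left.2 h, Set.union_eq_left.2 h0, avoiding_lor, val1_eq, clAll,
    Set.univ_inter]

theorem avoiding_eq_of_maskClosure_eq {m m' : ℕ} (h : maskClosure m = maskClosure m') :
    avoiding m = avoiding m' := by
  rw [← avoiding_maskClosure m, h, avoiding_maskClosure]

theorem avoiding_subset {m m' : ℕ} (h : maskClosure m ||| m' = maskClosure m) :
    avoiding m ⊆ avoiding m' := by
  rw [← avoiding_maskClosure m, ← h, avoiding_lor]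
  exact Set.inter_subset_right

theorem clC0_eq : clC0 = avoiding (mC ||| mVal false false) := by
  rw [clC0, clC_eq, val_eq, avoiding_lor]

theorem clC1_eq : clC1 = avoiding (mC ||| mVal true true) := by
  rw [clC1, clC_eq, val_eq, avoiding_lor]

theorem clC1_eq_neg : clC1 = neg clC0 := by
  rw [clC0_eq, clC1_eq, neg_avoiding]
  exact avoiding_eq_of_maskClosure_eq (by decide +kernel)

theorem clC0_eq_neg : clC0 = neg clC1 := by
  rw [clC0_eq, clC1_eq, neg_avoiding]
  exact avoiding_eq_of_maskClosure_eq (by decide +kernel)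

/-! ### Masks of the rows of the table -/

/-- Masks for the three classes of each row of the table. -/
def codes : List (ℕ × ℕ × ℕ) := [
  ⟨0,0,0⟩,
  ⟨mLe, mVal false true, mM⟩,
  ⟨mGe, mVal false true, mM⟩,
  ⟨mNe00, mVal false true, mU⟩,
  ⟨mNe11, mVal false true, mW⟩,
  ⟨mEq, mVal false true, 0⟩,
  ⟨mNe, mVal false true, mS⟩,
  ⟨mVal0C false, mVal0 false, mM⟩,
  ⟨mVal0C true, mVal0 false, mM⟩,
  ⟨mVal1C false, mVal1 true, mM⟩,
  ⟨mVal1C true, mVal1 true, mM⟩,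
  ⟨mVal0 false, mVal0 false, mVal0 false⟩,
  ⟨mVal0 true, mVal0 false, mVal1 true⟩,
  ⟨mVal1 false, mVal1 true, mVal0 false⟩,
  ⟨mVal1 true, mVal1 true, mVal1 true⟩,
  ⟨mVal0C false ||| mVal1C false, mVal false true, mM⟩,
  ⟨mVal0C true ||| mVal1C true, mVal false true, mM⟩,
  ⟨mVal false false, mVal false true, mVal0 false⟩,
  ⟨mVal true true, mVal false true, mVal1 true⟩,
  ⟨mVal0C false ||| mVal1C true, mVal false true, mM⟩,
  ⟨mVal0C true ||| mVal1C false, mVal false true, mM⟩,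
  ⟨mVal0 false ||| mVal1C true, mVal false true, mM ||| mVal0 false⟩,
  ⟨mVal0 true ||| mVal1C false, mVal false true, mM ||| mVal1 true⟩,
  ⟨mVal0C false ||| mVal1 true, mVal false true, mM ||| mVal1 true⟩,
  ⟨mVal0C true ||| mVal1 false, mVal false true, mM ||| mVal0 false⟩,
  ⟨mVal false true, mVal false true, mVal false true⟩,
  ⟨mVal true false, mVal false true, mVal false true⟩,
  ⟨mSmin, mS, mU⟩,
  ⟨mSmaj, mS, mW⟩,
  ⟨mSmin ||| mNe, mS ||| mVal false true, mS ||| mM⟩,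
  ⟨mSmaj ||| mNe, mS ||| mVal false true, mS ||| mM⟩,
  ⟨mSmin ||| mVal0 false, mS ||| mVal false true, mU⟩,
  ⟨mSmaj ||| mVal0 true, mS ||| mVal false true, mW⟩,
  ⟨mSmin ||| mVal1 false, mS ||| mVal false true, mU⟩,
  ⟨mSmaj ||| mVal1 true, mS ||| mVal false true, mW⟩,
  ⟨mSmin ||| mVal0 false ||| mVal1C true, mS ||| mVal false true, mM ||| mU⟩,
  ⟨mSmaj ||| mVal0 true ||| mVal1C false, mS ||| mVal false true, mM ||| mW⟩,
  ⟨mSmin ||| mVal0C true ||| mVal1 false, mS ||| mVal false true, mM ||| mU⟩,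
  ⟨mSmaj ||| mVal0C false ||| mVal1 true, mS ||| mVal false true, mM ||| mW⟩,
  ⟨mSmin ||| mVal false true, mS ||| mVal false true, mU ||| mVal false true⟩,
  ⟨mSmaj ||| mVal true false, mS ||| mVal false true, mW ||| mVal false true⟩,
  ⟨mSmin ||| mVal true false, mS ||| mVal false true, mU ||| mVal false true⟩,
  ⟨mSmaj ||| mVal false true, mS ||| mVal false true, mW ||| mVal false true⟩,
  ⟨mSmin ||| mVal false false, mS ||| mVal false true, mU⟩,
  ⟨mSmaj ||| mVal true true, mS ||| mVal false true, mW⟩,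
  ⟨mS, mS, mS⟩,
  ⟨mS ||| mVal false true, mS ||| mVal false true, mS ||| mVal false true⟩,
  ⟨flip (mS ||| mVal false true), mS ||| mVal false true, mS ||| mVal false true⟩,
  ⟨mM, mM, mM⟩,
  ⟨flip mM, mM, mM⟩,
  ⟨mM ||| mVal0 false, mM ||| mVal0 false, mM ||| mVal0 false⟩,
  ⟨flip (mM ||| mVal0 false), mM ||| mVal0 false, mM ||| mVal1 true⟩,
  ⟨mM ||| mVal1 true, mM ||| mVal1 true, mM ||| mVal1 true⟩,
  ⟨flip (mM ||| mVal1 true), mM ||| mVal1 true, mM ||| mVal0 false⟩,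
  ⟨mM ||| mVal false true, mM ||| mVal false true, mM ||| mVal false true⟩,
  ⟨flip (mM ||| mVal false true), mM ||| mVal false true, mM ||| mVal false true⟩,
  ⟨mS ||| mM, mS ||| mM, mS ||| mM⟩,
  ⟨flip (mS ||| mM), mS ||| mM, mS ||| mM⟩,
  ⟨mU, mU, mU⟩,
  ⟨flip mU, mU, mW⟩,
  ⟨mU ||| mVal0 false ||| mVal1C true, mU ||| mVal false true, mM ||| mU⟩,
  ⟨flip (mU ||| mVal0 false ||| mVal1C true), mU ||| mVal false true, mM ||| mW⟩,
  ⟨mU ||| mVal false true, mU ||| mVal false true, mU ||| mVal false true⟩,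
  ⟨flip (mU ||| mVal false true), mU ||| mVal false true, mW ||| mVal false true⟩,
  ⟨mM ||| mU, mM ||| mU, mM ||| mU⟩,
  ⟨flip (mM ||| mU), mM ||| mU, mM ||| mW⟩,
  ⟨mM ||| mU ||| mVal false true, mM ||| mU ||| mVal false true, mM ||| mU ||| mVal false true⟩,
  ⟨flip (mM ||| mU ||| mVal false true), mM ||| mU ||| mVal false true, mM ||| mW ||| mVal false true⟩,
  ⟨mW, mW, mW⟩,
  ⟨flip mW, mW, mU⟩,
  ⟨mW ||| mVal0C false ||| mVal1 true, mW ||| mVal false true, mM ||| mW⟩,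
  ⟨flip (mW ||| mVal0C false ||| mVal1 true), mW ||| mVal false true, mM ||| mU⟩,
  ⟨mW ||| mVal false true, mW ||| mVal false true, mW ||| mVal false true⟩,
  ⟨flip (mW ||| mVal false true), mW ||| mVal false true, mU ||| mVal false true⟩,
  ⟨mM ||| mW, mM ||| mW, mM ||| mW⟩,
  ⟨flip (mM ||| mW), mM ||| mW, mM ||| mU⟩,
  ⟨mM ||| mW ||| mVal false true, mM ||| mW ||| mVal false true, mM ||| mW ||| mVal false true⟩,
  ⟨flip (mM ||| mW ||| mVal false true), mM ||| mW ||| mVal false true, mM ||| mU ||| mVal false true⟩,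
  ⟨mU ||| mVal false false, mU ||| mVal false true, mU⟩,
  ⟨flip mU ||| mVal true true, mU ||| mVal false true, mW⟩,
  ⟨mW ||| mVal true true, mW ||| mVal false true, mW⟩,
  ⟨flip mW ||| mVal false false, mW ||| mVal false true, mU⟩,
  ⟨mU ||| flip mW, mS ||| mM, mU⟩,
  ⟨mW ||| flip mU, mS ||| mM, mW⟩,
  ⟨mR, mS, 0⟩,
  ⟨mR ||| mVal0C false ||| mVal1C false, mS ||| mVal false true, mM⟩,
  ⟨mR ||| mVal0C true ||| mVal1C true, mS ||| mVal false true, mM⟩,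
  ⟨mR ||| mVal false false, mS ||| mVal false true, mVal0 false⟩,
  ⟨mR ||| mVal true true, mS ||| mVal false true, mVal1 true⟩,
  ⟨mC, 0, 0⟩,
  ⟨mC ||| mVal false false, 0, mVal0 false⟩,
  ⟨mC ||| mVal true true, 0, mVal1 true⟩,
  ⟨bit 9 (ix false false) ||| bit 9 (ix true true), 0, 0⟩]

/-- The masks of a row define its three classes. -/
def Encodes (r : Row) (c : ℕ × ℕ × ℕ) : Prop :=
  r.K = avoiding c.1 ∧ r.right = avoiding c.2.1 ∧ r.left = avoiding c.2.2

theorem neg_union (A B : BoolClass) : neg A ∪ neg B = neg (A ∪ B) :=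
  (Set.image_union _ _ _).symm

theorem val_false_true_union_clC0 {K : BoolClass} (h : clC0 ⊆ K) :
    val K false true ∪ clC0 = K ∩ avoiding (mVal0 false ||| mVal1C true) :=
  val_union_const_left h

theorem val_true_false_union_clC1 {K : BoolClass} (h : clC1 ⊆ K) :
    val K true false ∪ clC1 = K ∩ avoiding (mVal0 true ||| mVal1C false) :=
  val_union_const_left h

theorem val_true_false_union_clC0 {K : BoolClass} (h : clC0 ⊆ K) :
    val K true false ∪ clC0 = K ∩ avoiding (mVal0C true ||| mVal1 false) :=
  val_union_const_right h

theorem val_false_true_union_clC1 {K : BoolClass} (h : clC1 ⊆ K) :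
    val K false true ∪ clC1 = K ∩ avoiding (mVal0C false ||| mVal1 true) :=
  val_union_const_right h

theorem encodes_table : List.Forall₂ Encodes table codes := by
  have hC : clC ⊆ clAll := Set.subset_univ _
  have hR : clC ⊆ clRefl := fun f hf a => (hf.choose_spec a).trans (hf.choose_spec _).symm
  have h0 : clC0 ⊆ clAll := Set.subset_univ _
  have h1 : clC1 ⊆ clAll := Set.subset_univ _
  have hSmin : clC0 ⊆ clSmin := by
    rw [clC0_eq, clSmin_eq]; exact avoiding_subset (by decide +kernel)
  have hSmaj : clC1 ⊆ clSmaj := by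
    rw [clC1_eq, clSmaj_eq]; exact avoiding_subset (by decide +kernel)
  have hU : clC0 ⊆ clU := by
    rw [clC0_eq, clU_eq]; exact avoiding_subset (by decide +kernel)
  have hW : clC1 ⊆ clW := by
    rw [clC1_eq, clW_eq]; exact avoiding_subset (by decide +kernel)
  have hTcU : clTcU ∪ clC0 = _ := val_false_true_union_clC0 hU
  have hTcW : clTcW ∪ clC1 = _ := val_false_true_union_clC1 hW
  have hnTcU : neg clTcU ∪ clC1 = neg (clTcU ∪ clC0) := by rw [clC1_eq_neg, neg_union]
  have hnTcW : neg clTcW ∪ clC0 = neg (clTcW ∪ clC1) := by rw [clC0_eq_neg, neg_union]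
  unfold table codes
  repeat' first
    | exact List.Forall₂.nil
    | refine List.Forall₂.cons ⟨?_, ?_, ?_⟩ ?_
  all_goals
    simp only [↓val0_union_clC, ↓val1_union_clC, ↓val_union_clC hC, ↓val_union_clC hR,
      ↓val_false_true_union_clC0 h0, ↓val_true_false_union_clC1 h1,
      ↓val_true_false_union_clC0 h0, ↓val_false_true_union_clC1 h1,
      ↓val_false_true_union_clC0 hSmin, ↓val_true_false_union_clC1 hSmaj,
      ↓val_true_false_union_clC0 hSmin, ↓val_false_true_union_clC1 hSmaj,
      ↓hTcU, ↓hTcW, ↓hnTcU, ↓hnTcW, clT0, clT1, clTc, clM0, clM1, clMc, clSc, clSM, clTcU, clMU,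
      clMcU, clTcW, clMW, clMcW, val_eq, val0_eq, val1_eq, valEq_eq, valNe_eq, valLe_eq, valGe_eq,
      valNe00_eq, valNe11_eq, clAll_eq, clRefl_eq, clS_eq, clSmin_eq, clSmaj_eq, clM_eq, clU_eq,
      clW_eq, clC0_eq, clC1_eq, clC_eq, empty_eq, ← avoiding_lor, neg_avoiding]
  all_goals exact avoiding_eq_of_maskClosure_eq (by decide +kernel)

/-! ### Enumeration of the stable classes -/

/-- The closed masks of the classes in the table. -/
def masks : List ℕ := codes.map fun c => maskClosure c.1

/-- Single forbidden pairs that represent all of them up to closure. -/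
def generators : List ℕ := [bit 1 0, bit 1 3, bit 2 0, bit 2 1, bit 2 2, bit 2 3, bit 3 1, bit 3 2,
  bit 6 0, bit 6 1, bit 6 3, bit 7 0, bit 7 1, bit 7 3, bit 8 0, bit 8 3, bit 9 0, bit 9 3,
  bit 10 1, bit 10 2, bit 11 1, bit 11 2, bit 14 0, bit 14 3]

theorem consistent_masks : ∀ m ∈ masks, Consistent m := by decide +kernel

theorem nodup_masks : masks.Nodup := by decide +kernel

theorem maskClosure_bit : ∀ T < 16, ∀ k < 4, maskClosure (bit T k) = maskClosure 0 ∨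
    ∃ g ∈ generators, maskClosure (bit T k) = maskClosure g := by
  decide +kernel

/-- The masks in the table are closed under adding a forbidden pair. -/
theorem masks_closed : (masks.all fun m => generators.all fun g =>
    Nat.beq (Nat.land m g) g || masks.any (Nat.beq (maskClosure (m ||| g)))) = true := by
  decide +kernel

theorem maskClosure_rightMask : ∀ c ∈ codes,
    maskClosure (rightMask (maskClosure c.1)) = maskClosure c.2.1 := by decide +kernel

theorem maskClosure_leftMask : ∀ c ∈ codes,
    maskClosure (leftMask (maskClosure c.1)) = maskClosure c.2.2 := by decide +kernel

theorem exists_mask_inter {m : ℕ} (hm : m ∈ masks) {T k : ℕ} (hT : T < 16) (hk : k < 4) :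
    ∃ m' ∈ masks, avoiding m ∩ avoiding (bit T k) = avoiding m' := by
  obtain h | ⟨g, hg, h⟩ := maskClosure_bit T hT k hk
  · refine ⟨m, hm, ?_⟩
    rw [avoiding_eq_of_maskClosure_eq h, avoiding_zero, clAll, Set.inter_univ]
  · rw [avoiding_eq_of_maskClosure_eq h, ← avoiding_lor]
    have h1 := List.all_eq_true.1 (List.all_eq_true.1 masks_closed m hm) g hg
    rw [Bool.or_eq_true] at h1
    rcases h1 with h1 | h1
    · refine ⟨m, hm, ?_⟩
      have h2 : m &&& g = g := Nat.eq_of_beq_eq_true h1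
      refine congrArg avoiding (Nat.eq_of_testBit_eq fun j => ?_)
      rw [← h2, Nat.testBit_or, Nat.testBit_and]
      cases m.testBit j <;> simp
    · obtain ⟨m', hm', h2⟩ := List.any_eq_true.1 h1
      refine ⟨m', hm', ?_⟩
      rw [← Nat.eq_of_beq_eq_true h2, avoiding_maskClosure]

/-- Every class defined by forbidden pairs has a mask in the table. -/
theorem exists_mask (L : Finset (ℕ × Bool × Bool)) (hL : ∀ l ∈ L, l.1 < 16) : ∃ m ∈ masks,
    {f : BoolFun | ∀ l ∈ L, f ∈ avoiding (bit l.1 (ix l.2.1 l.2.2))} = avoiding m := by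
  classical
  induction L using Finset.induction_on with
  | empty =>
    refine ⟨maskClosure 0, by decide +kernel, ?_⟩
    rw [avoiding_maskClosure, avoiding_zero]
    simp [clAll]
  | insert l L _ ih =>
    obtain ⟨m, hm, h⟩ := ih fun l' hl' => hL l' (Finset.mem_insert_of_mem hl')
    obtain ⟨m', hm', h'⟩ := exists_mask_inter hm (hL l (Finset.mem_insert_self _ _))
      (ix_lt l.2.1 l.2.2)
    refine ⟨m', hm', ?_⟩
    rw [← h', ← h]
    ext f
    simp only [Finset.mem_insert, forall_eq_or_imp, Set.mem_inter_iff, Set.mem_ofPred_eq]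
    exact and_comm

theorem exists_mask_of_isStable {K : BoolClass} (hK : IsStable clIc clSM K) :
    ∃ m ∈ masks, K = avoiding m := by
  classical
  obtain ⟨m, hm, h⟩ := exists_mask ((Finset.range 16 ×ˢ Finset.univ).filter fun l =>
    K ⊆ avoiding (bit l.1 (ix l.2.1 l.2.2))) fun l hl => by simp_all
  refine ⟨m, hm, ?_⟩
  rw [← h]
  refine subset_antisymm (fun f hf l hl => ?_) fun f hf => ?_
  · have hl' : K ⊆ avoiding (bit l.1 (ix l.2.1 l.2.2)) := (Finset.mem_filter.1 hl).2
    exact hl' hf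
  · exact mem_of_stable hK fun T hT x y hTxy =>
      hf (T, x, y) (Finset.mem_filter.2 ⟨by simp [hT], hTxy⟩)

theorem avoiding_injOn : Set.InjOn avoiding {m | m ∈ masks} := by
  have hlt : ∀ m ∈ masks, m < 2 ^ 64 := by decide +kernel
  have key : ∀ m ∈ masks, ∀ m' ∈ masks, avoiding m ⊆ avoiding m' →
      ∀ j, m'.testBit j = true → m.testBit j = true := by
    intro m hm m' hm' hsub j hj
    have hj64 : j < 64 := by
      by_contra h
      rw [Nat.testBit_lt_two_pow ((hlt m' hm').trans_le
        (Nat.pow_le_pow_right (by norm_num) (not_lt.1 h)))] at hj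
      exact absurd hj (by decide)
    obtain ⟨x, y, hxy⟩ := exists_ix (Nat.mod_lt j (by norm_num : 0 < 4))
    have hT : j / 4 < 16 := by omega
    have hj' : j = 4 * (j / 4) + ix x y := by omega
    rw [hj'] at hj ⊢
    by_contra hx
    obtain ⟨a, b, hab⟩ := (consistent_masks m hm).exists_witness hT
    obtain ⟨hcols, f, hf, rfl, rfl⟩ := hab x y (by simpa using hx)
    rw [hsub hf _ hT a b hcols] at hj
    exact absurd hj (by decide)
  intro m hm m' hm' h
  refine Nat.eq_of_testBit_eq fun j => Bool.eq_iff_iff.2 ⟨?_, ?_⟩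
  · exact key m' hm' m hm h.symm.subset j
  · exact key m hm m' hm' h.subset j

theorem forall₂_exists_right {α β : Type*} {R : α → β → Prop} {l : List α} {l' : List β}
    (h : List.Forall₂ R l l') {a : α} (ha : a ∈ l) : ∃ b ∈ l', R a b := by
  induction h with
  | nil => simp at ha
  | cons hab _ ih =>
    rcases List.mem_cons.1 ha with rfl | ha
    · exact ⟨_, List.mem_cons_self, hab⟩
    · obtain ⟨b, hb, hab⟩ := ih ha
      exact ⟨b, List.mem_cons_of_mem _ hb, hab⟩

theorem exists_code {r : Row} (hr : r ∈ table) : ∃ c ∈ codes, Encodes r c :=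
  forall₂_exists_right encodes_table hr

theorem exists_row {c : ℕ × ℕ × ℕ} (hc : c ∈ codes) : ∃ r ∈ table, Encodes r c :=
  forall₂_exists_right encodes_table.flip hc

theorem isStable_iff_exists_mask {K : BoolClass} :
    IsStable clIc clSM K ↔ ∃ m ∈ masks, avoiding m = K := by
  constructor
  · intro hK
    obtain ⟨m, hm, h⟩ := exists_mask_of_isStable hK
    exact ⟨m, hm, h.symm⟩
  · rintro ⟨m, _, rfl⟩
    exact isStable_avoiding m

theorem isStable_iff_exists_row {K : BoolClass} :
    IsStable clIc clSM K ↔ ∃ r ∈ table, r.K = K := by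
  rw [isStable_iff_exists_mask]
  constructor
  · rintro ⟨_, hm, rfl⟩
    obtain ⟨c, hc, rfl⟩ := List.mem_map.1 hm
    obtain ⟨r, hr, h⟩ := exists_row hc
    exact ⟨r, hr, h.1.trans (avoiding_maskClosure _).symm⟩
  · rintro ⟨r, hr, rfl⟩
    obtain ⟨c, hc, h⟩ := exists_code hr
    exact ⟨_, List.mem_map_of_mem hc, (avoiding_maskClosure _).trans h.1.symm⟩

theorem ncard_isStable : Set.ncard {K : BoolClass | IsStable clIc clSM K} = 93 := by
  have h1 : {K : BoolClass | IsStable clIc clSM K} = avoiding '' {m | m ∈ masks} := by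
    ext K
    exact isStable_iff_exists_mask
  have h2 : {m | m ∈ masks} = (masks.toFinset : Set ℕ) := by
    ext m; simp
  rw [h1, avoiding_injOn.ncard_image, h2, Set.ncard_coe_finset,
    List.toFinset_card_of_nodup nodup_masks]
  rfl

theorem row_spec {r : Row} (hr : r ∈ table) : IsClone r.right ∧ IsClone r.left ∧
    ∀ C : BoolClass, IsClone C →
      (comp r.K C ⊆ r.K ↔ C ⊆ r.right) ∧ (comp C r.K ⊆ r.K ↔ C ⊆ r.left) := by
  obtain ⟨c, hc, hK, hright, hleft⟩ := exists_code hr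
  have hm : Consistent (maskClosure c.1) :=
    consistent_masks _ (List.mem_map.2 ⟨c, hc, rfl⟩)
  have hR := avoiding_eq_of_maskClosure_eq (maskClosure_rightMask c hc)
  have hL := avoiding_eq_of_maskClosure_eq (maskClosure_leftMask c hc)
  rw [← avoiding_maskClosure] at hK
  rw [← hright, avoiding_rightMask] at hR
  rw [← hleft, avoiding_leftMask] at hL
  generalize maskClosure c.1 = m at *
  rw [hK, ← hR, ← hL]
  exact ⟨isClone_pol _, isClone_pol _, fun C hC =>
    ⟨hm.comp_subset_iff_right hC, hm.comp_subset_iff_left C⟩⟩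

theorem comp_mono {A B C : Type*} {I I' : FunClass B C} {J J' : FunClass A B} (hI : I ⊆ I')
    (hJ : J ⊆ J') : comp I J ⊆ comp I' J' := by
  rintro _ ⟨n, m, f, g, hf, hg, rfl⟩
  exact ⟨n, m, f, g, hI hf, fun i => hJ (hg i), rfl⟩

end BoolMinion

theorem theorem5p1 :
    -- the stable classes for projections and self-dual monotone functions are exactly those listed
    (∀ K : BoolMinion.BoolClass,
      BoolMinion.IsStable BoolMinion.clIc BoolMinion.clSM K ↔
        ∃ r ∈ BoolMinion.table, r.K = K) ∧
    -- and there are 93 of them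
    Set.ncard {K : BoolMinion.BoolClass |
      BoolMinion.IsStable BoolMinion.clIc BoolMinion.clSM K} = 93 ∧
    BoolMinion.table.length = 93 ∧
    -- the two table entries of each class are clones with the stated property
    (∀ r ∈ BoolMinion.table,
      BoolMinion.IsClone r.right ∧ BoolMinion.IsClone r.left ∧
      ∀ C : BoolMinion.BoolClass, BoolMinion.IsClone C →
        (BoolMinion.comp r.K C ⊆ r.K ↔ C ⊆ r.right) ∧
        (BoolMinion.comp C r.K ⊆ r.K ↔ C ⊆ r.left)) ∧
    -- the resulting description of the stable classes for all pairs of clones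
    (∀ C₁ C₂ : BoolMinion.BoolClass, BoolMinion.IsClone C₁ → BoolMinion.IsClone C₂ →
      BoolMinion.clSM ⊆ C₂ →
      ∀ K : BoolMinion.BoolClass,
        BoolMinion.IsStable C₁ C₂ K ↔
          ∃ r ∈ BoolMinion.table, r.K = K ∧ C₁ ⊆ r.right ∧ C₂ ⊆ r.left) := by
  refine ⟨fun K => BoolMinion.isStable_iff_exists_row, BoolMinion.ncard_isStable, rfl,
    fun r hr => BoolMinion.row_spec hr, fun C₁ C₂ h₁ h₂ hSM K => ⟨fun hK => ?_, ?_⟩⟩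
  · obtain ⟨r, hr, rfl⟩ := BoolMinion.isStable_iff_exists_row.1
      ⟨(BoolMinion.comp_mono subset_rfl h₁.1).trans hK.1,
        (BoolMinion.comp_mono hSM subset_rfl).trans hK.2⟩
    have h := (BoolMinion.row_spec hr).2.2
    exact ⟨r, hr, rfl, (h C₁ h₁).1.1 hK.1, (h C₂ h₂).2.1 hK.2⟩
  · rintro ⟨r, hr, rfl, hr₁, hr₂⟩
    have h := (BoolMinion.row_spec hr).2.2
    exact ⟨(h C₁ h₁).1.2 hr₁, (h C₂ h₂).2.2 hr₂⟩
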